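/- Theorem (the forward SDR after downsampling). There is a universal constant $\kappa>0$ such that the following holds. Let $\mathbf X=(X_t)_{t\in\mathbb Z}$ be a real, zero mean, weakly stationary process whose autocovariance $C_{xx}(\tau)=\mathbb E[X_tX_{t+\tau}]$ is absolutely summable and whose power spectral density $S_{xx}(\nu)=\sum_\tau C_{xx}(\tau)e^{-2\pi i\nu\tau}$ is strictly positive. Let $m,D\ge 1$ and $k$ be integers. For $b\in\mathbb R^m$ let $\mathbf Y=\mathbf h*\mathbf X$, where $\mathbf h$ is the finite impulse response with $h_{k+i}=b_i$ for $0\le i\le m-1$ and $h_\tau=0$ for all other $\tau$. Let $\mathbf a$ be an ideal anti-aliasing filter: a real sequence whose frequency response satisfies $|\widehat{\mathbf a}(\nu)|=1$ for $|\nu|<1/(2D)$ and $\widehat{\mathbf a}(\nu)=0$ for all other $|\nu|\le 1/2$. Let $\widetilde X_j=(\mathbf a*\mathbf X)_{jD}$ and $\widetilde Y_j=(\mathbf a*\mathbf Y)_{jD}$, $j\in\mathbb Z$, the convolutions with $\mathbf a$ being mean square sums. Then these sums converge, and $\widetilde{\mathbf X},\widetilde{\mathbf Y}$ are weakly stationary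 with power spectral densities $S_{\tilde x\tilde x},S_{\tilde y\tilde y}$ (nonnegative integrable functions on $[-1/2,1/2]$ whose Fourier coefficients are the autocovariances). Write $\langle f\rangle=\int_{-1/2}^{1/2}f(\nu)\,d\nu$ and $$\rho_{\widetilde{\mathbf X}\to\widetilde{\mathbf Y}}=\frac{\langle S_{\tilde y\tilde y}\rangle}{\langle S_{\tilde x\tilde x}\rangle\,\langle S_{\tilde y\tilde y}/S_{\tilde x\tilde x}\rangle},\qquad K=\frac{\max_{|\nu|<1/(2D)}S_{xx}(\nu)}{\int_0^{1/(2D)}S_{xx}(\nu)\,d\nu}$$ (the maximum being read as a supremum). If $b$ is drawn from a spherically symmetric probability distribution on $\mathbb R^m$ with $\mathbb P(b=0)=0$, the process $\mathbf X$ (hence $S_{xx}$) being fixed, then for every $\epsilon$ with $0<\epsilon<1/2$, $$\bigl|\rho_{\widetilde{\mathbf X}\to\widetilde{\mathbf Y}}-1\bigr|\le\epsilon\Bigl(K+(1+\epsilon K)\,\frac{2}{1-2\epsilon}\Bigr)$$ with probability at least $\bigl(1-\exp(-\kappa(m-1)\epsilon^2)\bigr)^2$. -/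

import Mathlib

open MeasureTheory Filter Topology

noncomputable section

/-- The discrete-time Fourier transform `ĉ(ν) = ∑ₜ cₜ exp(-2πiνt)` of a summable sequence. -/
def dtft (c : ℤ → ℝ) (ν : ℝ) : ℂ :=
  ∑' t : ℤ, (c t : ℂ) * Complex.exp (-(2 * Real.pi * Complex.I * ν * t))

/-- The average `⟨f⟩` of a function over the unit frequency interval `[-1/2, 1/2]`. -/
def freqAvg (f : ℝ → ℝ) : ℝ := ∫ ν in (-1 / 2 : ℝ)..(1 / 2), f ν

section Processes

variable {Ω : Type*} [MeasurableSpace Ω]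

/-- A real, zero mean, weakly stationary process. -/
structure IsWeaklyStationary (P : Measure Ω) (X : ℤ → Ω → ℝ) : Prop where
  memLp : ∀ t, MemLp (X t) 2 P
  mean_zero : ∀ t, ∫ ω, X t ω ∂P = 0
  cov_shift : ∀ t τ, ∫ ω, X t ω * X (t + τ) ω ∂P = ∫ ω, X 0 ω * X τ ω ∂P

/-- The autocovariance function `C(τ) = E[X₀ X_τ]` of a weakly stationary process. -/
def autocov (P : Measure Ω) (X : ℤ → Ω → ℝ) (τ : ℤ) : ℝ := ∫ ω, X 0 ω * X τ ω ∂P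

/-- The power spectral density of a weakly stationary process with summable autocovariance:
the discrete-time Fourier transform of the autocovariance (which is real, `C` being even). -/
def psd (P : Measure Ω) (X : ℤ → Ω → ℝ) (ν : ℝ) : ℝ := (dtft (autocov P X) ν).re

/-- `S` is a power spectral density of `X`, without summability of the autocovariance:
`X` is weakly stationary, `S` is nonnegative and integrable on `[-1/2, 1/2]`, and the
autocovariances are its Fourier coefficients. Such an `S` is unique up to null sets, and it is
the discrete-time Fourier transform of the autocovariance when the latter is summable. An ideal
filter has a discontinuous frequency response, so its outputs require this generality. -/
structure IsSpectralDensity (P : Measure Ω) (X : ℤ → Ω → ℝ) (S : ℝ → ℝ) : Prop where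
  stationary : IsWeaklyStationary P X
  integrable : IntervalIntegrable S volume (-1 / 2 : ℝ) (1 / 2)
  nonneg : ∀ᵐ ν ∂volume, ν ∈ Set.Icc (-1 / 2 : ℝ) (1 / 2) → 0 ≤ S ν
  fourier : ∀ τ : ℤ, (autocov P X τ : ℂ) =
    ∫ ν in (-1 / 2 : ℝ)..(1 / 2), (S ν : ℂ) * Complex.exp (2 * Real.pi * Complex.I * ν * τ)

open Classical in
/-- The (almost everywhere unique) power spectral density of `X`, when there is one. -/
def spectralDensity (P : Measure Ω) (X : ℤ → Ω → ℝ) : ℝ → ℝ :=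
  if h : ∃ S, IsSpectralDensity P X S then h.choose else 0

/-- The spectral dependency ratio
`ρ_{X → Y} = ⟨S_yy⟩ / (⟨S_xx⟩ ⟨S_yy / S_xx⟩)`. -/
def sdr (P : Measure Ω) (X Y : ℤ → Ω → ℝ) : ℝ :=
  freqAvg (spectralDensity P Y) /
    (freqAvg (spectralDensity P X) *
      freqAvg (fun ν => spectralDensity P Y ν / spectralDensity P X ν))

/-- The output `Y_t = ∑_τ h_τ X_{t-τ}` of a linear filter. It is used here for impulse responses
of finite support only, for which the sum is finite. -/
def filterOutput (h : ℤ → ℝ) (X : ℤ → Ω → ℝ) (t : ℤ) (ω : Ω) : ℝ :=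
  ∑' τ : ℤ, h τ * X (t - τ) ω

/-- `Z` is the mean square sum `∑_τ a_τ X_{t-τ}`. -/
def IsMeanSquareOutput (P : Measure Ω) (a : ℤ → ℝ) (X : ℤ → Ω → ℝ) (t : ℤ) (Z : Ω → ℝ) : Prop :=
  MemLp Z 2 P ∧
    Tendsto (fun F : Finset ℤ => eLpNorm (fun ω => Z ω - ∑ τ ∈ F, a τ * X (t - τ) ω) 2 P)
      atTop (𝓝 0)

open Classical in
/-- The output `a * X` of a linear filter whose impulse response need not be absolutely summable:
each coordinate is the (almost surely unique) mean square sum, when there is one. -/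
def meanSquareOutput (P : Measure Ω) (a : ℤ → ℝ) (X : ℤ → Ω → ℝ) (t : ℤ) : Ω → ℝ :=
  if h : ∃ Z, IsMeanSquareOutput P a X t Z then h.choose else 0

/-- Filtering by `a`, then keeping one time point out of `D`: `X̃_k = (a * X)_{kD}`. -/
def downsample (P : Measure Ω) (a : ℤ → ℝ) (D : ℕ) (X : ℤ → Ω → ℝ) (k : ℤ) : Ω → ℝ :=
  meanSquareOutput P a X (k * D)

/-- The filtered series exists as a mean square sum, and the decimated series
has a power spectral density. -/
def DownsampleWellDefined (P : Measure Ω) (a : ℤ → ℝ) (D : ℕ) (X : ℤ → Ω → ℝ) : Prop :=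
  (∀ t, ∃ Z, IsMeanSquareOutput P a X t Z) ∧
    ∃ S, IsSpectralDensity P (downsample P a D X) S

end Processes

/-- The real sequence `a` is the impulse response of an ideal anti-aliasing filter for decimation
by `D`: its frequency response `A` satisfies `|A(ν)| = 1` if `|ν| < 1/(2D)` and `A(ν) = 0` for the
other `|ν| ≤ 1/2`. The phase is free. -/
def IsIdealAntiAliasing (D : ℕ) (a : ℤ → ℝ) : Prop :=
  ∃ A : ℝ → ℂ, Measurable A ∧
    (∀ ν : ℝ, |ν| ≤ 1 / 2 → ‖A ν‖ = if |ν| < 1 / (2 * (D : ℝ)) then 1 else 0) ∧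
    ∀ n : ℤ, (a n : ℂ) =
      ∫ ν in (-1 / 2 : ℝ)..(1 / 2), A ν * Complex.exp (2 * Real.pi * Complex.I * ν * n)

/-- The impulse response with `h_{k+i} = bᵢ` for `0 ≤ i < m` and `h = 0` elsewhere. -/
def firResponse {m : ℕ} (k : ℤ) (b : EuclideanSpace ℝ (Fin m)) (n : ℤ) : ℝ :=
  ∑ i : Fin m, if n = k + (i : ℕ) then b i else 0

/-- A spherically symmetric distribution on `ℝᵐ`. -/
def IsSphericallySymmetric {m : ℕ} (μ : Measure (EuclideanSpace ℝ (Fin m))) : Prop :=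
  ∀ U : EuclideanSpace ℝ (Fin m) ≃ₗᵢ[ℝ] EuclideanSpace ℝ (Fin m), μ.map U = μ

/-- `K = max_{|ν| < 1/(2D)} S(ν) / ∫₀^{1/(2D)} S(ν) dν`, the maximum being read as a supremum. -/
def bandConstant (D : ℕ) (S : ℝ → ℝ) : ℝ :=
  sSup (S '' {ν : ℝ | |ν| < 1 / (2 * (D : ℝ))}) / ∫ ν in (0 : ℝ)..(1 / (2 * (D : ℝ))), S ν

end

/-! Stretching the band `|ν| < 1/(2D)` to the unit interval gives the decimated series the densities
`S(ν/D)/D` and `|ĥ(ν/D)|² S(ν/D)/D`; the phases of both filters disappear. With `I = ∫ S(ν/D) dν`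
this yields `ρ - 1 = K M(b)/T(b)`, where `T(b) = ∫ |ĥ(ν/D)|² dν` and `M(b) = K⁻¹ ∫ |ĥ(ν/D)|²
(S(ν/D)/I - 1) dν` are quadratic forms in `b` (`sdr_sub_one_estimates`). The weight in `M` has mean
zero, so `tr M = 0`, while `tr T = m`; from `S/I ≤ K/(2D)` one gets `|M| ≤ T/(2D) ≤ ‖b‖²/2`.

If `ε ≥ 1/(2D)`, then `|M| ≤ εT` always. Otherwise the set where `|M| ≤ εT` and `T > 0` is a cone,
so only the direction of `b` matters and its law may be replaced by the standard Gaussian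
(`measure_cone_eq_stdGaussian`). Put `u = ε√m`. For `u ≥ 8`, Chernoff bounds for `±M - εT`, of trace
`-εm`, give failure probability at most `2 exp(-u²/8)`. For `u ≤ 8` a lower bound linear in `u` is
enough, because `(1 - exp(-κu²))²` is of order `u⁴`. It comes from a change of sign: with
probability bounded below, two independent Gaussian vectors have `M ≤ 0` and `M ≥ 0`, so `M`
vanishes somewhere on the arc between them. There `M` varies at rate `O(√m)` while `T` is at least a
constant times `m`, so the cone contains an arc of length of order `u`; averaging over rotations
turns this length into a probability.

The deviation obtained is `εK`, stronger than the stated bound. -/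

/-! ### Exponential moments of Gaussian quadratic forms -/

open ProbabilityTheory in
theorem integral_exp_mul_sq_gaussianReal {t : ℝ} (ht : t < 1) :
    ∫ x, Real.exp (t / 2 * x ^ 2) ∂(gaussianReal 0 1) = 1 / √(1 - t) := by
  rw [integral_gaussianReal_eq_integral_smul one_ne_zero]
  have h : ∀ x : ℝ, gaussianPDFReal 0 1 x • Real.exp (t / 2 * x ^ 2)
      = (√(2 * Real.pi))⁻¹ * Real.exp (-((1 - t) / 2) * x ^ 2) := by
    intro x
    simp only [gaussianPDFReal, smul_eq_mul, NNReal.coe_one, mul_one, sub_zero]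
    rw [mul_assoc, ← Real.exp_add]
    congr 2; ring
  simp_rw [h]
  rw [integral_const_mul, integral_gaussian, ← Real.sqrt_inv, ← Real.sqrt_mul (by positivity),
    ← Real.sqrt_one, ← Real.sqrt_div zero_le_one, Real.sqrt_one]
  congr 1
  have : 1 - t ≠ 0 := by linarith
  field_simp

/-- The quadratic form of a matrix on Euclidean space. -/
def quadForm {ι : Type*} [Fintype ι] (A : Matrix ι ι ℝ) (x : EuclideanSpace ℝ ι) : ℝ :=
  ∑ i, ∑ j, x i * x j * A i j

section QuadForm

variable {ι : Type*} [Fintype ι]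

theorem continuous_quadForm (A : Matrix ι ι ℝ) : Continuous (quadForm A) := by
  unfold quadForm
  fun_prop

theorem measurable_quadForm (A : Matrix ι ι ℝ) : Measurable (quadForm A) :=
  (continuous_quadForm A).measurable

theorem quadForm_smul_matrix (c : ℝ) (A : Matrix ι ι ℝ) (x : EuclideanSpace ℝ ι) :
    quadForm (c • A) x = c * quadForm A x := by
  simp only [quadForm, Finset.mul_sum, Matrix.smul_apply, smul_eq_mul]
  exact Finset.sum_congr rfl fun i _ => Finset.sum_congr rfl fun j _ => by ring

theorem quadForm_sub (A B : Matrix ι ι ℝ) (x : EuclideanSpace ℝ ι) :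
    quadForm (A - B) x = quadForm A x - quadForm B x := by
  simp only [quadForm, ← Finset.sum_sub_distrib, Matrix.sub_apply]
  exact Finset.sum_congr rfl fun i _ => Finset.sum_congr rfl fun j _ => by ring

theorem quadForm_neg (A : Matrix ι ι ℝ) (x : EuclideanSpace ℝ ι) :
    quadForm (-A) x = - quadForm A x := by
  simp [quadForm]

theorem quadForm_smul (A : Matrix ι ι ℝ) (c : ℝ) (x : EuclideanSpace ℝ ι) :
    quadForm A (c • x) = c ^ 2 * quadForm A x := by
  simp only [quadForm, Finset.mul_sum, PiLp.smul_apply, smul_eq_mul]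
  exact Finset.sum_congr rfl fun i _ => Finset.sum_congr rfl fun j _ => by ring

theorem quadForm_eq_inner [DecidableEq ι] (A : Matrix ι ι ℝ) (x : EuclideanSpace ℝ ι) :
    quadForm A x = inner ℝ x (Matrix.toEuclideanLin A x) := by
  simp only [quadForm, PiLp.inner_apply, Matrix.toLpLin_apply, Matrix.mulVec, dotProduct,
    RCLike.inner_apply, conj_trivial, Finset.sum_mul]
  exact Finset.sum_congr rfl fun i _ => Finset.sum_congr rfl fun j _ => by ring

variable [DecidableEq ι] {A : Matrix ι ι ℝ}

theorem quadForm_sum_eigenvectorBasis (hA : A.IsHermitian) (y : ι → ℝ) :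
    quadForm A (∑ i, y i • hA.eigenvectorBasis i) = ∑ i, hA.eigenvalues i * y i ^ 2 := by
  have h : ∀ i, Matrix.toEuclideanLin A (hA.eigenvectorBasis i)
      = hA.eigenvalues i • hA.eigenvectorBasis i := by
    intro i
    have := hA.mulVec_eigenvectorBasis i
    ext j
    simpa [Matrix.toLpLin_apply] using congrFun this j
  rw [quadForm_eq_inner, map_sum]
  simp only [map_smul, h, sum_inner, inner_sum, inner_smul_left, inner_smul_right,
    OrthonormalBasis.inner_eq_ite]
  simp only [conj_trivial, mul_ite, mul_one, mul_zero, Finset.sum_ite_eq', Finset.mem_univ, if_true]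
  exact Finset.sum_congr rfl fun i _ => by ring

theorem quadForm_eigenvectorBasis (hA : A.IsHermitian) (i : ι) :
    quadForm A (hA.eigenvectorBasis i) = hA.eigenvalues i := by
  have := quadForm_sum_eigenvectorBasis hA (Pi.single i 1)
  simpa [Pi.single_apply, ite_pow] using this

theorem sum_eigenvalues_eq_trace (hA : A.IsHermitian) : ∑ i, hA.eigenvalues i = A.trace := by
  have := hA.trace_eq_sum_eigenvalues
  simpa using this.symm

theorem abs_eigenvalues_le (hA : A.IsHermitian) {c : ℝ}
    (h : ∀ x, |quadForm A x| ≤ c * ‖x‖ ^ 2) (i : ι) : |hA.eigenvalues i| ≤ c := by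
  have := h (hA.eigenvectorBasis i)
  rwa [quadForm_eigenvectorBasis, hA.eigenvectorBasis.norm_eq_one, one_pow, mul_one] at this

-- In an eigenbasis of `A` the Gaussian is again a product of standard normal laws, so the integral
-- splits into one-variable integrals.
open ProbabilityTheory in
theorem integral_exp_quadForm_stdGaussian (hA : A.IsHermitian) {t : ℝ}
    (ht : ∀ i, t * hA.eigenvalues i < 1) :
    ∫ x, Real.exp (t / 2 * quadForm A x) ∂(stdGaussian (EuclideanSpace ℝ ι))
      = ∏ i, 1 / √(1 - t * hA.eigenvalues i) := by
  rw [stdGaussian_eq_map_pi_orthonormalBasis hA.eigenvectorBasis,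
    integral_map (Measurable.aemeasurable (by fun_prop))
      (((measurable_quadForm A).const_mul _).exp.aestronglyMeasurable)]
  simp_rw [quadForm_sum_eigenvectorBasis, Finset.mul_sum, Real.exp_sum]
  rw [integral_fintype_prod_eq_prod
    (f := fun i x => Real.exp (t / 2 * (hA.eigenvalues i * x ^ 2)))]
  refine Finset.prod_congr rfl fun i _ => ?_
  rw [← integral_exp_mul_sq_gaussianReal (ht i)]
  congr 1; ext x; congr 1; ring

open ProbabilityTheory in
theorem integrable_exp_quadForm_stdGaussian (hA : A.IsHermitian) {t : ℝ}
    (ht : ∀ i, t * hA.eigenvalues i < 1) :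
    Integrable (fun x => Real.exp (t / 2 * quadForm A x))
      (stdGaussian (EuclideanSpace ℝ ι)) := by
  -- A non-integrable function has Bochner integral zero, whereas the closed formula is positive.
  by_contra h
  have h1 := integral_exp_quadForm_stdGaussian hA ht
  rw [integral_undef h] at h1
  have : 0 < ∏ i, 1 / √(1 - t * hA.eigenvalues i) :=
    Finset.prod_pos fun i _ => one_div_pos.2 (Real.sqrt_pos.2 (by linarith [ht i]))
  linarith

end QuadForm

/-! ### Tails, sign and small ball estimates for Gaussian quadratic forms -/

theorem abs_add_log_one_sub_le {x : ℝ} (hx : |x| ≤ 1 / 4) :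
    |x + x ^ 2 / 2 + Real.log (1 - x)| ≤ x ^ 2 / 3 := by
  -- The Taylor remainder is at most `|x|³/(1 - |x|)`, and `|x|/(1 - |x|) ≤ 1/3` when `|x| ≤ 1/4`.
  have h := Real.abs_log_sub_add_sum_range_le (x := x) (by linarith) 2
  simp only [Finset.sum_range_succ, Finset.sum_range_zero, zero_add] at h
  norm_num at h
  refine h.trans ?_
  rw [div_le_iff₀ (by linarith), pow_succ, sq_abs]
  nlinarith [sq_nonneg x, abs_nonneg x]

theorem one_div_sqrt_one_sub {x : ℝ} (hx : x < 1) :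
    1 / √(1 - x) = Real.exp (-(Real.log (1 - x)) / 2) := by
  have h : 0 < 1 - x := by linarith
  rw [Real.sqrt_eq_rpow, Real.rpow_def_of_pos h, one_div, ← Real.exp_neg]
  congr 1; ring

theorem one_div_sqrt_one_sub_le {x : ℝ} (hx : |x| ≤ 1 / 4) :
    1 / √(1 - x) ≤ Real.exp (x / 2 + x ^ 2 / 2) := by
  rw [one_div_sqrt_one_sub (by linarith [le_abs_self x]), Real.exp_le_exp]
  have := abs_le.1 (abs_add_log_one_sub_le hx)
  nlinarith [sq_nonneg x]

/-- The positive quadratic term is what pushes the exponential moment of a traceless form strictly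
above 1. -/
theorem le_one_div_sqrt_one_sub {x : ℝ} (hx : |x| ≤ 1 / 4) :
    Real.exp (x / 2 + x ^ 2 / 12) ≤ 1 / √(1 - x) := by
  rw [one_div_sqrt_one_sub (by linarith [le_abs_self x]), Real.exp_le_exp]
  have := abs_le.1 (abs_add_log_one_sub_le hx)
  nlinarith [sq_nonneg x]

theorem one_add_sum_le_prod_one_add_of_nonneg {ι : Type*} (s : Finset ι) {f : ι → ℝ}
    (hf : ∀ i, 0 ≤ f i) : 1 + ∑ i ∈ s, f i ≤ ∏ i ∈ s, (1 + f i) := by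
  classical
  induction s using Finset.induction_on with
  | empty => simp
  | insert a s ha ih =>
    rw [Finset.sum_insert ha, Finset.prod_insert ha]
    nlinarith [hf a, mul_nonneg (hf a) (Finset.sum_nonneg fun i (_ : i ∈ s) => hf i)]

section Tails

open ProbabilityTheory

variable {ι : Type*} [Fintype ι] [DecidableEq ι] {A : Matrix ι ι ℝ}

theorem mgf_quadForm_le (hA : A.IsHermitian) {t : ℝ}
    (ht : ∀ i, |t * hA.eigenvalues i| ≤ 1 / 4) :
    mgf (quadForm A) (stdGaussian (EuclideanSpace ℝ ι)) (t / 2)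
      ≤ Real.exp (t / 2 * A.trace + t ^ 2 / 2 * ∑ i, hA.eigenvalues i ^ 2) := by
  rw [mgf, integral_exp_quadForm_stdGaussian hA
    (fun i => (le_abs_self _).trans_lt ((ht i).trans_lt (by norm_num))),
    ← sum_eigenvalues_eq_trace hA, Finset.mul_sum, Finset.mul_sum, ← Finset.sum_add_distrib,
    Real.exp_sum]
  refine Finset.prod_le_prod (fun i _ => by positivity) fun i _ => ?_
  refine (one_div_sqrt_one_sub_le (ht i)).trans (le_of_eq ?_)
  congr 1; ring

theorem le_mgf_quadForm (hA : A.IsHermitian) {t : ℝ}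
    (ht : ∀ i, |t * hA.eigenvalues i| ≤ 1 / 4) :
    Real.exp (t / 2 * A.trace + t ^ 2 / 12 * ∑ i, hA.eigenvalues i ^ 2) ≤
      mgf (quadForm A) (stdGaussian (EuclideanSpace ℝ ι)) (t / 2) := by
  rw [mgf, integral_exp_quadForm_stdGaussian hA
    (fun i => (le_abs_self _).trans_lt ((ht i).trans_lt (by norm_num))),
    ← sum_eigenvalues_eq_trace hA, Finset.mul_sum, Finset.mul_sum, ← Finset.sum_add_distrib,
    Real.exp_sum]
  refine Finset.prod_le_prod (fun i _ => by positivity) fun i _ => ?_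
  refine (le_of_eq ?_).trans (le_one_div_sqrt_one_sub (ht i))
  congr 1; ring

theorem quadForm_tail_le (hA : A.IsHermitian) {t : ℝ} (ht0 : 0 ≤ t)
    (ht : ∀ i, |t * hA.eigenvalues i| ≤ 1 / 4) (a : ℝ) :
    (stdGaussian (EuclideanSpace ℝ ι)).real {x | a ≤ quadForm A x}
      ≤ Real.exp (-(t / 2 * a) + t / 2 * A.trace
          + t ^ 2 / 2 * ∑ i, hA.eigenvalues i ^ 2) := by
  refine (measure_ge_le_exp_mul_mgf a (by positivity : 0 ≤ t / 2)
    (integrable_exp_quadForm_stdGaussian hA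
      (fun i => (le_abs_self _).trans_lt ((ht i).trans_lt (by norm_num))))).trans ?_
  rw [add_assoc, Real.exp_add, neg_mul]
  gcongr
  exact mgf_quadForm_le hA ht

/-- Chernoff bound for the sign of a quadratic form of negative trace. -/
theorem quadForm_nonneg_prob_le (hA : A.IsHermitian) {ε : ℝ} (hε0 : 0 ≤ ε) (hε : ε ≤ 1 / 2)
    (hb : ∀ x, |quadForm A x| ≤ ‖x‖ ^ 2) (htr : A.trace = -(ε * Fintype.card ι)) :
    (stdGaussian (EuclideanSpace ℝ ι)).real {x | 0 ≤ quadForm A x}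
      ≤ Real.exp (-(ε ^ 2 * Fintype.card ι / 8)) := by
  have hl : ∀ i, |hA.eigenvalues i| ≤ 1 := abs_eigenvalues_le hA (by simpa using hb)
  -- With `t = ε/2` and `∑ λᵢ² ≤ n`, the exponent is at most `-ε²n/4 + ε²n/8`.
  refine (quadForm_tail_le hA (t := ε / 2) (by positivity) (fun i => ?_) 0).trans ?_
  · rw [abs_mul, abs_of_nonneg (by positivity : 0 ≤ ε / 2)]
    nlinarith [hl i, abs_nonneg (hA.eigenvalues i)]
  · rw [Real.exp_le_exp, htr]
    have : ∑ i, hA.eigenvalues i ^ 2 ≤ Fintype.card ι := by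
      have := Finset.sum_le_sum fun i (_ : i ∈ Finset.univ) =>
        (sq_le_one_iff_abs_le_one (hA.eigenvalues i)).2 (hl i)
      simpa using this
    nlinarith [mul_le_mul_of_nonneg_left this (sq_nonneg ε)]

/-- The eigenvalues are at most `1/2` in modulus, so `∑ λᵢ² ≤ n/4` and the form fluctuates on the
scale `√n`. Chernoff with `t = 1/(2√n)` gives `2 exp(1/32 - C/4)`, independent of the dimension. -/
theorem stdGaussian_abs_quadForm_tail {δ : ℝ} (hδ : 0 < δ) :
    ∃ C : ℝ, 8 ≤ C ∧ ∀ (ι : Type) [Fintype ι] [DecidableEq ι] [Nonempty ι] (A : Matrix ι ι ℝ),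
      A.IsHermitian → A.trace = 0 → (∀ x, |quadForm A x| ≤ 1 / 2 * ‖x‖ ^ 2) →
      (stdGaussian (EuclideanSpace ℝ ι)).real {x | C * √(Fintype.card ι) ≤ |quadForm A x|} ≤ δ := by
  obtain ⟨C, hC8, hC⟩ : ∃ C : ℝ, 8 ≤ C ∧ 2 * Real.exp (1 / 32 - C / 4) ≤ δ := by
    have : Tendsto (fun C : ℝ => 2 * Real.exp (1 / 32 - C / 4)) atTop (𝓝 (2 * 0)) := by
      refine Tendsto.const_mul _ (Real.tendsto_exp_atBot.comp ?_)
      exact tendsto_atBot_add_const_left _ _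
        (tendsto_neg_atTop_atBot.comp (tendsto_id.atTop_div_const (by norm_num)))
    rw [mul_zero] at this
    obtain ⟨C, h1, h2⟩ := ((eventually_ge_atTop 8).and (this.eventually_le_const hδ)).exists
    exact ⟨C, h1, h2⟩
  refine ⟨C, hC8, fun ι _ _ _ A hA htr hb => ?_⟩
  have key : ∀ A : Matrix ι ι ℝ, A.IsHermitian → A.trace = 0 →
      (∀ x, |quadForm A x| ≤ 1 / 2 * ‖x‖ ^ 2) →
      (stdGaussian (EuclideanSpace ℝ ι)).real {x | C * √(Fintype.card ι) ≤ quadForm A x}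
        ≤ Real.exp (1 / 32 - C / 4) := by
    intro A hA htr hb
    have hl := abs_eigenvalues_le hA hb
    have hn : (1 : ℝ) ≤ Fintype.card ι := by exact_mod_cast Fintype.card_pos
    have hs : 1 ≤ √(Fintype.card ι : ℝ) := Real.one_le_sqrt.2 hn
    have hs2 : √(Fintype.card ι : ℝ) ^ 2 = Fintype.card ι := Real.sq_sqrt (by positivity)
    refine (quadForm_tail_le hA (t := 1 / (2 * √(Fintype.card ι : ℝ))) (by positivity)
      (fun i => ?_) _).trans ?_
    · rw [abs_mul, abs_of_nonneg (by positivity), one_div_mul_eq_div, div_le_iff₀ (by positivity)]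
      linarith [hl i]
    · rw [Real.exp_le_exp, htr]
      have h1 : ∑ i, hA.eigenvalues i ^ 2 ≤ Fintype.card ι * (1 / 4) := by
        have := Finset.sum_le_sum fun i (_ : i ∈ Finset.univ) =>
          (sq_le_sq.2 ((hl i).trans (le_abs_self _)) : hA.eigenvalues i ^ 2 ≤ (1 / 2) ^ 2)
        refine this.trans (le_of_eq ?_)
        simp; norm_num
      have h2 : (1 / (2 * √(Fintype.card ι : ℝ))) ^ 2 / 2 = 1 / (8 * Fintype.card ι) := by
        rw [div_pow, mul_pow, hs2]; field_simp; norm_num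
      rw [h2]
      have h3 : 1 / (8 * (Fintype.card ι : ℝ)) * ∑ i, hA.eigenvalues i ^ 2 ≤ 1 / 32 := by
        rw [one_div_mul_eq_div, div_le_iff₀ (by positivity)]; linarith
      have h4 : 1 / (2 * √(Fintype.card ι : ℝ)) / 2 * (C * √(Fintype.card ι : ℝ)) = C / 4 := by
        field_simp; norm_num
      rw [h4]; linarith
  have h1 := key A hA htr hb
  have h2 := key (-A) hA.neg (by simp [htr]) (by simpa [quadForm_neg] using hb)
  have hsub : {x | C * √(Fintype.card ι) ≤ |quadForm A x|} ⊆
      {x | C * √(Fintype.card ι) ≤ quadForm A x} ∪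
        {x | C * √(Fintype.card ι) ≤ quadForm (-A) x} := by
    intro x hx
    simpa [quadForm_neg, le_abs] using hx
  refine (measureReal_mono hsub).trans ((measureReal_union_le _ _).trans ?_)
  linarith

/-- A traceless quadratic form in Gaussian variables is nonnegative with a probability
that is bounded below. -/
theorem stdGaussian_quadForm_nonneg (hA : A.IsHermitian) (htr : A.trace = 0) :
    1 / 2000000 ≤ (stdGaussian (EuclideanSpace ℝ ι)).real {x | 0 ≤ quadForm A x} := by
  set γ := stdGaussian (EuclideanSpace ℝ ι)
  set V := ∑ i, hA.eigenvalues i ^ 2 with hV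
  have hV0 : 0 ≤ V := Finset.sum_nonneg fun i _ => sq_nonneg _
  rcases hV0.eq_or_lt with h0 | hpos
  · have hz : ∀ i, hA.eigenvalues i = 0 := fun i => by
      have := (Finset.sum_eq_zero_iff_of_nonneg (fun i _ => sq_nonneg (hA.eigenvalues i))).1
        h0.symm i (Finset.mem_univ i)
      exact pow_eq_zero_iff (two_ne_zero) |>.1 this
    have : A = 0 := hA.eigenvalues_eq_zero_iff.1 (funext hz)
    have hset : {x : EuclideanSpace ℝ ι | 0 ≤ quadForm A x} = Set.univ := by
      ext x; simp [this, quadForm]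
    rw [hset, probReal_univ]; norm_num
  -- This scale gives `t²V = 1/64`, which keeps `tλᵢ` and `2tλᵢ` in the range of the Taylor
  -- estimates.
  · set t := 1 / (8 * √V) with ht
    have hsV : 0 < √V := Real.sqrt_pos.2 hpos
    have htV : t ^ 2 * V = 1 / 64 := by
      rw [ht, div_pow, mul_pow, Real.sq_sqrt hV0]; field_simp; norm_num
    have hli : ∀ i, |hA.eigenvalues i| ≤ √V := fun i => by
      rw [← Real.sqrt_sq_eq_abs]
      exact Real.sqrt_le_sqrt (Finset.single_le_sum (f := fun i => hA.eigenvalues i ^ 2)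
        (fun i _ => sq_nonneg _) (Finset.mem_univ i))
    have htl : ∀ i, |t * hA.eigenvalues i| ≤ 1 / 8 := fun i => by
      rw [abs_mul, abs_of_nonneg (by positivity), ht, one_div_mul_eq_div,
        div_le_iff₀ (by positivity)]
      linarith [hli i]
    have htl2 : ∀ i, |2 * t * hA.eigenvalues i| ≤ 1 / 4 := fun i => by
      rw [mul_assoc, abs_mul, abs_two]; linarith [htl i]
    have i1 := integrable_exp_quadForm_stdGaussian hA (t := t)
      (fun i => (le_abs_self _).trans_lt ((htl i).trans_lt (by norm_num)))
    have i2 := integrable_exp_quadForm_stdGaussian hA (t := 2 * t)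
      (fun i => (le_abs_self _).trans_lt ((htl2 i).trans_lt (by norm_num)))
    have l1 := le_mgf_quadForm hA (t := t) (fun i => (htl i).trans (by norm_num))
    have l2 := mgf_quadForm_le hA (t := 2 * t) htl2
    rw [htr, mul_zero, zero_add] at l1 l2
    rw [← hV, show t ^ 2 / 12 * V = 1 / 768 by linarith] at l1
    rw [← hV, show (2 * t) ^ 2 / 2 * V = 1 / 32 by nlinarith] at l2
    have l1' := (Real.add_one_le_exp (1 / 768 : ℝ)).trans l1
    have l2' : mgf (quadForm A) γ (2 * t / 2) ≤ 2 := l2.trans <| by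
      have := Real.exp_bound_div_one_sub_of_interval (x := 1 / 32) (by norm_num) (by norm_num)
      exact this.trans (by norm_num)
    have hms : MeasurableSet {x : EuclideanSpace ℝ ι | 0 ≤ quadForm A x} :=
      measurableSet_le measurable_const (measurable_quadForm A)
    -- Pointwise `e^y ≤ 1 + 768·1_{y ≥ 0} + e^{2y}/3072`: complete the square if `y ≥ 0`, use `e^y ≤
    -- 1` otherwise. Since the moment is at least `1 + 1/768` and the second moment at most 2, the
    -- probability is at least `1/(768·1536)`.
    have key : mgf (quadForm A) γ (t / 2) ≤
        1 + (768 * γ.real {x | 0 ≤ quadForm A x} + 1 / 3072 * mgf (quadForm A) γ (2 * t / 2)) := by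
      have hint : Integrable ({x | 0 ≤ quadForm A x}.indicator
          (fun _ => (768 : ℝ))) γ := (integrable_const _).indicator hms
      have : ∫ x, {x | 0 ≤ quadForm A x}.indicator (fun _ => (768 : ℝ)) x ∂γ
          = 768 * γ.real {x | 0 ≤ quadForm A x} := by
        rw [integral_indicator_const _ hms, smul_eq_mul, mul_comm]
      have hint2 : Integrable (fun x => {x | 0 ≤ quadForm A x}.indicator (fun _ => (768 : ℝ)) x
          + 1 / 3072 * Real.exp (2 * t / 2 * quadForm A x)) γ := hint.add (i2.const_mul _)
      have e1 : ∫ x, (1 + ({x | 0 ≤ quadForm A x}.indicator (fun _ => (768 : ℝ)) x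
          + 1 / 3072 * Real.exp (2 * t / 2 * quadForm A x))) ∂γ
          = 1 + (768 * γ.real {x | 0 ≤ quadForm A x}
            + 1 / 3072 * mgf (quadForm A) γ (2 * t / 2)) := by
        rw [integral_add (integrable_const _) hint2, integral_add hint (i2.const_mul _), this, integral_const_mul, mgf]
        simp [γ]
      rw [← e1]
      refine integral_mono i1 ((integrable_const _).add hint2) fun x => ?_
      have hsq : Real.exp (2 * t / 2 * quadForm A x) = Real.exp (t / 2 * quadForm A x) ^ 2 := by
        rw [← Real.exp_nat_mul]; congr 1; push_cast; ring
      simp only [hsq]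
      by_cases hx : 0 ≤ quadForm A x
      · rw [Set.indicator_of_mem (by exact hx)]
        nlinarith [sq_nonneg (Real.exp (t / 2 * quadForm A x) - 1536)]
      · have : Real.exp (t / 2 * quadForm A x) ≤ 1 := by
          rw [Real.exp_le_one_iff]
          have : 0 ≤ t := by positivity
          nlinarith [not_le.1 hx]
        rw [Set.indicator_of_notMem (by exact hx)]
        nlinarith [sq_nonneg (Real.exp (t / 2 * quadForm A x))]
    linarith

/-- Small ball estimate for a positive semidefinite form. -/
theorem stdGaussian_posSemidef_small_ball [Nonempty ι] (hA : A.IsHermitian)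
    (hpos : ∀ x, 0 ≤ quadForm A x)
    (htr : A.trace = Fintype.card ι) {η : ℝ} (hη : 0 < η) :
    (stdGaussian (EuclideanSpace ℝ ι)).real {x | quadForm A x ≤ η * Fintype.card ι}
      ≤ 2 * √η := by
  have hn : (0 : ℝ) < Fintype.card ι := by exact_mod_cast Fintype.card_pos
  have hl : ∀ i, 0 ≤ hA.eigenvalues i := fun i => by
    rw [← quadForm_eigenvectorBasis]; exact hpos _
  -- The Markov factor becomes `exp(1/2) ≤ 2`, and the product of the `1 - tλᵢ` is at least `1 - t
  -- tr A = 1 + 1/η`.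
  set t : ℝ := -(1 / (η * Fintype.card ι)) with ht
  have ht0 : t ≤ 0 := by rw [ht]; simp; positivity
  have htl : ∀ i, t * hA.eigenvalues i < 1 := fun i => by nlinarith [hl i]
  refine (measure_le_le_exp_mul_mgf (t := t / 2) _ (by linarith)
    (integrable_exp_quadForm_stdGaussian hA htl)).trans ?_
  rw [mgf, integral_exp_quadForm_stdGaussian hA htl]
  have h1 : Real.exp (-(t / 2) * (η * Fintype.card ι)) ≤ 2 := by
    rw [show -(t / 2) * (η * Fintype.card ι) = 1 / 2 by rw [ht]; field_simp]
    have := Real.exp_bound_div_one_sub_of_interval (x := 1 / 2) (by norm_num) (by norm_num)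
    exact this.trans (by norm_num)
  have h2 : ∏ i, 1 / √(1 - t * hA.eigenvalues i) ≤ √η := by
    have h3 : ∏ i, 1 / √(1 - t * hA.eigenvalues i)
        = 1 / √(∏ i, (1 + -t * hA.eigenvalues i)) := by
      rw [Finset.prod_div_distrib, Finset.prod_const_one, Real.sqrt_prod]
      · congr 1; refine Finset.prod_congr rfl fun i _ => ?_; congr 1; ring
      · intro i _; nlinarith [hl i]
    have h4 : 1 / η ≤ ∏ i, (1 + -t * hA.eigenvalues i) := by
      have := one_add_sum_le_prod_one_add_of_nonneg Finset.univ
        (f := fun i => -t * hA.eigenvalues i) (fun i => by nlinarith [hl i])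
      rw [← Finset.mul_sum, sum_eigenvalues_eq_trace, htr] at this
      have e : -t * (Fintype.card ι : ℝ) = 1 / η := by rw [ht]; field_simp
      linarith
    rw [h3]
    calc 1 / √(∏ i, (1 + -t * hA.eigenvalues i)) ≤ 1 / √(1 / η) := by gcongr
      _ = √η := by rw [Real.sqrt_div zero_le_one]; simp
  exact mul_le_mul h1 h2 (Finset.prod_nonneg fun i _ => by positivity) (by norm_num)

end Tails

/-! ### Rotating a pair of independent Gaussian vectors -/

section Circle

open ProbabilityTheory

theorem stdGaussian_prod_map_rotation {E : Type*} [NormedAddCommGroup E] [InnerProductSpace ℝ E]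
    [FiniteDimensional ℝ E] [MeasurableSpace E] [BorelSpace E] (θ : ℝ) :
    ((stdGaussian E).prod (stdGaussian E)).map (fun p => Real.cos θ • p.1 + Real.sin θ • p.2)
      = stdGaussian E := by
  have h : ((stdGaussian E).prod (stdGaussian E)).map
      (fun p => Real.cos θ • p.1 + Real.sin θ • p.2)
      = ((stdGaussian E).map (Real.cos θ • ·)).conv ((stdGaussian E).map (Real.sin θ • ·)) := by
    rw [Measure.conv, Measure.map_prod_map _ _ (by fun_prop) (by fun_prop),
      Measure.map_map (by fun_prop) (by fun_prop)]
    rfl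
  have : IsProbabilityMeasure ((stdGaussian E).map (Real.cos θ • ·)) :=
    Measure.isProbabilityMeasure_map (by fun_prop)
  have : IsProbabilityMeasure ((stdGaussian E).map (Real.sin θ • ·)) :=
    Measure.isProbabilityMeasure_map (by fun_prop)
  rw [h]
  apply Measure.ext_of_charFun
  ext t
  rw [charFun_conv, charFun_map_smul, charFun_map_smul, charFun_stdGaussian, charFun_stdGaussian,
    charFun_stdGaussian, ← Complex.exp_add]
  congr 1
  simp only [norm_smul, mul_pow, Real.norm_eq_abs, Complex.ofReal_mul, ← Complex.ofReal_pow, sq_abs]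
  rw [← Complex.ofReal_mul, ← Complex.ofReal_mul]
  norm_cast
  linear_combination (-(‖t‖ ^ 2) / 2) * Real.cos_sq_add_sin_sq θ

/-- Value at angle `θ` of a quadratic form with values `α`, `β` at two points, and polar
form `h` between them. -/
noncomputable def circleForm (α β h θ : ℝ) : ℝ :=
  Real.cos θ ^ 2 * α + Real.sin θ ^ 2 * β + 2 * (Real.cos θ * Real.sin θ) * h

theorem circleForm_neg (α β h θ : ℝ) : circleForm α β h (-θ) = circleForm α β (-h) θ := by
  simp only [circleForm, Real.cos_neg, Real.sin_neg]; ring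

/-- In the double angle `2θ` the cosine and sine amplitudes are at most `L` and `2L`, so the slope
is at most `2L + 4L`. -/
theorem circleForm_lipschitz {α β h L : ℝ} (hα : |α| ≤ L) (hβ : |β| ≤ L) (hh : |h| ≤ 2 * L)
    (x y : ℝ) : |circleForm α β h x - circleForm α β h y| ≤ 6 * L * |x - y| := by
  have e : ∀ θ, circleForm α β h θ
      = (α + β) / 2 + (α - β) / 2 * Real.cos (2 * θ) + h * Real.sin (2 * θ) := by
    intro θ
    rw [circleForm, Real.cos_two_mul, Real.sin_two_mul, Real.sin_sq]; ring
  have hc : |Real.cos (2 * x) - Real.cos (2 * y)| ≤ 2 * |x - y| := by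
    have := Real.abs_cos_sub_cos_le (2 * x) (2 * y)
    rwa [← mul_sub, abs_mul, abs_two] at this
  have hs : |Real.sin (2 * x) - Real.sin (2 * y)| ≤ 2 * |x - y| := by
    have := Real.abs_sin_sub_sin_le (2 * x) (2 * y)
    rwa [← mul_sub, abs_mul, abs_two] at this
  have hab : |(α - β) / 2| ≤ L := by
    rw [abs_le] at *; constructor <;> linarith
  have hL : 0 ≤ L := (abs_nonneg _).trans hα
  rw [e, e, show (α + β) / 2 + (α - β) / 2 * Real.cos (2 * x) + h * Real.sin (2 * x)
    - ((α + β) / 2 + (α - β) / 2 * Real.cos (2 * y) + h * Real.sin (2 * y))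
    = (α - β) / 2 * (Real.cos (2 * x) - Real.cos (2 * y))
      + h * (Real.sin (2 * x) - Real.sin (2 * y)) by ring]
  refine (abs_add_le _ _).trans ?_
  rw [abs_mul, abs_mul]
  have h1 := mul_le_mul hab hc (abs_nonneg _) hL
  have h2 := mul_le_mul hh hs (abs_nonneg _) (by positivity)
  linarith

/-- The first form vanishes somewhere on the quarter circle and stays small nearby by its Lipschitz
bound. The second is at least `η` on the whole quarter circle, its cross term being nonnegative
there. As `δ ≤ π/4`, an arc of length `δ` fits on one side of the zero. -/
theorem exists_interval_circleForm_le_of_nonneg {α β h α' β' h' L η δ : ℝ} (hα0 : α ≤ 0)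
    (hβ0 : 0 ≤ β)
    (hα : |α| ≤ L) (hβ : |β| ≤ L) (hh : |h| ≤ 2 * L) (hα' : η ≤ α') (hβ' : η ≤ β')
    (hh' : 0 ≤ h') (hδ : 0 ≤ δ) (hδ' : δ ≤ Real.pi / 4) :
    ∃ a, Set.Icc a (a + δ) ⊆ {θ | θ ∈ Set.Icc 0 (Real.pi / 2) ∧
      η ≤ circleForm α' β' h' θ ∧ |circleForm α β h θ| ≤ 6 * L * δ} := by
  have hL : 0 ≤ L := (abs_nonneg _).trans hα
  have hcont : Continuous (circleForm α β h) := by unfold circleForm; fun_prop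
  have hpi := Real.pi_pos
  obtain ⟨x, hx, hx0⟩ : (0 : ℝ) ∈ circleForm α β h '' Set.Icc 0 (Real.pi / 2) := by
    refine intermediate_value_Icc (by positivity) hcont.continuousOn ⟨?_, ?_⟩
    · simpa [circleForm] using hα0
    · simpa [circleForm] using hβ0
  have key : ∀ θ ∈ Set.Icc 0 (Real.pi / 2), |θ - x| ≤ δ → θ ∈ {θ | θ ∈ Set.Icc 0 (Real.pi / 2) ∧
      η ≤ circleForm α' β' h' θ ∧ |circleForm α β h θ| ≤ 6 * L * δ} := by
    intro θ hθ hθx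
    refine ⟨hθ, ?_, ?_⟩
    · have hs : 0 ≤ Real.sin θ := Real.sin_nonneg_of_nonneg_of_le_pi hθ.1 (by linarith [hθ.2])
      have hc : 0 ≤ Real.cos θ :=
        Real.cos_nonneg_of_neg_pi_div_two_le_of_le (by linarith [hθ.1]) hθ.2
      have := mul_nonneg (mul_nonneg hc hs) hh'
      have h1 : Real.cos θ ^ 2 * η + Real.sin θ ^ 2 * η = η := by
        rw [← add_mul, Real.cos_sq_add_sin_sq, one_mul]
      rw [circleForm]
      nlinarith [mul_le_mul_of_nonneg_left hα' (sq_nonneg (Real.cos θ)),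
        mul_le_mul_of_nonneg_left hβ' (sq_nonneg (Real.sin θ))]
    · have := circleForm_lipschitz hα hβ hh θ x
      rw [hx0, sub_zero] at this
      exact this.trans (by gcongr)
  by_cases hxp : x ≤ Real.pi / 4
  · refine ⟨x, fun θ hθ => key θ ⟨hx.1.trans hθ.1, ?_⟩ ?_⟩
    · linarith [hθ.2]
    · rw [abs_le]; constructor <;> linarith [hθ.1, hθ.2]
  · refine ⟨x - δ, fun θ hθ => key θ ⟨?_, ?_⟩ ?_⟩
    · linarith [hθ.1]
    · linarith [hθ.2, hx.2]
    · rw [abs_le]; constructor <;> linarith [hθ.1, hθ.2]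

/-- The reflection `θ ↦ -θ` changes the sign of `h'`, so one of the two quarter circles always has a
nonnegative cross term. -/
theorem exists_interval_circleForm_le {α β h α' β' h' L η δ : ℝ} (hα0 : α ≤ 0)
    (hβ0 : 0 ≤ β)
    (hα : |α| ≤ L) (hβ : |β| ≤ L) (hh : |h| ≤ 2 * L) (hα' : η ≤ α') (hβ' : η ≤ β')
    (hδ : 0 ≤ δ) (hδ' : δ ≤ Real.pi / 4) :
    ∃ a, Set.Icc a (a + δ) ⊆ {θ | θ ∈ Set.Icc (-(Real.pi / 2)) (Real.pi / 2) ∧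
      η ≤ circleForm α' β' h' θ ∧ |circleForm α β h θ| ≤ 6 * L * δ} := by
  have hpi := Real.pi_pos
  rcases le_total 0 h' with h0 | h0
  · obtain ⟨a, ha⟩ := exists_interval_circleForm_le_of_nonneg hα0 hβ0 hα hβ hh hα' hβ' h0 hδ hδ'
    refine ⟨a, fun θ hθ => ?_⟩
    obtain ⟨h1, h2⟩ := ha hθ
    exact ⟨⟨by linarith [h1.1], h1.2⟩, h2⟩
  · obtain ⟨a, ha⟩ := exists_interval_circleForm_le_of_nonneg hα0 hβ0 hα hβ
      ((abs_neg h).le.trans hh) hα' hβ' (neg_nonneg.2 h0) hδ hδ'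
    refine ⟨-(a + δ), fun θ hθ => ?_⟩
    obtain ⟨h1, h2⟩ := ha (⟨by linarith [hθ.2], by linarith [hθ.1]⟩ : -θ ∈ Set.Icc a (a + δ))
    rw [circleForm_neg, circleForm_neg, neg_neg, neg_neg] at h2
    exact ⟨⟨by linarith [h1.2], by linarith [h1.1]⟩, h2⟩

/-- The polar form of a quadratic form. -/
noncomputable def polarForm {ι : Type*} [Fintype ι] (A : Matrix ι ι ℝ) (x y : EuclideanSpace ℝ ι) : ℝ :=
  ∑ i, ∑ j, x i * y j * A i j

theorem quadForm_circle {ι : Type*} [Fintype ι] {A : Matrix ι ι ℝ} (hA : A.IsHermitian)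
    (x y : EuclideanSpace ℝ ι) (θ : ℝ) :
    quadForm A (Real.cos θ • x + Real.sin θ • y)
      = circleForm (quadForm A x) (quadForm A y) (polarForm A x y) θ := by
  have hsymm : ∑ i, ∑ j, y i * x j * A i j = polarForm A x y := by
    rw [polarForm, Finset.sum_comm]
    refine Finset.sum_congr rfl fun i _ => Finset.sum_congr rfl fun j _ => ?_
    have : A j i = A i j := by simpa using hA.apply i j
    rw [this]; ring
  have : circleForm (quadForm A x) (quadForm A y) (polarForm A x y) θ
      = Real.cos θ ^ 2 * quadForm A x + Real.sin θ ^ 2 * quadForm A y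
        + Real.cos θ * Real.sin θ * polarForm A x y
        + Real.cos θ * Real.sin θ * ∑ i, ∑ j, y i * x j * A i j := by
    rw [hsymm, circleForm]; ring
  rw [this]
  simp only [quadForm, polarForm, Finset.mul_sum, ← Finset.sum_add_distrib, PiLp.add_apply,
    PiLp.smul_apply, smul_eq_mul]
  exact Finset.sum_congr rfl fun i _ => Finset.sum_congr rfl fun j _ => by ring

variable {ι : Type} [Fintype ι]

/-- At angle `π/4` the form equals the mean of its two end values plus the polar form; three values
thus control the whole circle. -/
theorem abs_polarForm_le {A : Matrix ι ι ℝ} (hA : A.IsHermitian) {x y : EuclideanSpace ℝ ι}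
    {L : ℝ} (hx : |quadForm A x| ≤ L) (hy : |quadForm A y| ≤ L)
    (hxy : |quadForm A (Real.cos (Real.pi / 4) • x + Real.sin (Real.pi / 4) • y)| ≤ L) :
    |polarForm A x y| ≤ 2 * L := by
  rw [quadForm_circle hA, circleForm, Real.cos_pi_div_four, Real.sin_pi_div_four] at hxy
  have h2 : √2 ^ 2 = (2 : ℝ) := Real.sq_sqrt (by norm_num)
  rw [show (√2 / 2) ^ 2 * quadForm A x + (√2 / 2) ^ 2 * quadForm A y
    + 2 * (√2 / 2 * (√2 / 2)) * polarForm A x y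
    = √2 ^ 2 / 4 * (quadForm A x + quadForm A y + 2 * polarForm A x y) by ring, h2] at hxy
  rw [abs_le] at *
  constructor <;> linarith

/-- Averaging a Gaussian probability over the rotations in the plane of two independent
Gaussian vectors. -/
theorem mul_prod_le_pi_mul_stdGaussian {E : Type*} [NormedAddCommGroup E] [InnerProductSpace ℝ E]
    [FiniteDimensional ℝ E] [MeasurableSpace E] [BorelSpace E] {S : Set E} (hS : MeasurableSet S)
    {G : Set (E × E)} (hG : MeasurableSet G) {δ : ℝ}
    (h : ∀ p ∈ G, ENNReal.ofReal δ ≤ (volume.restrict (Set.Icc (-(Real.pi / 2)) (Real.pi / 2)))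
      {θ | Real.cos θ • p.1 + Real.sin θ • p.2 ∈ S}) :
    ENNReal.ofReal δ * ((stdGaussian E).prod (stdGaussian E)) G
      ≤ ENNReal.ofReal Real.pi * stdGaussian E S := by
  set Λ : Measure ℝ := volume.restrict (Set.Icc (-(Real.pi / 2)) (Real.pi / 2))
  set γ2 := (stdGaussian E).prod (stdGaussian E)
  have hcont : Continuous fun q : (E × E) × ℝ =>
      Real.cos q.2 • q.1.1 + Real.sin q.2 • q.1.2 := by fun_prop
  set W : Set ((E × E) × ℝ) := {q | Real.cos q.2 • q.1.1 + Real.sin q.2 • q.1.2 ∈ S} with hW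
  have hWm : MeasurableSet W := hcont.measurable hS
  -- Tonelli in both orders: a fixed pair sees an arc, while a fixed angle sees a standard Gaussian
  -- vector.
  have e1 : (γ2.prod Λ) W = ∫⁻ p, Λ {θ | Real.cos θ • p.1 + Real.sin θ • p.2 ∈ S} ∂γ2 :=
    Measure.prod_apply hWm
  have e2 : (γ2.prod Λ) W = ENNReal.ofReal Real.pi * stdGaussian E S := by
    rw [Measure.prod_apply_symm hWm]
    have : ∀ θ, γ2 ((fun x => (x, θ)) ⁻¹' W) = stdGaussian E S := by
      intro θ
      conv_rhs => rw [← stdGaussian_prod_map_rotation θ]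
      rw [Measure.map_apply (by fun_prop) hS]
      rfl
    simp_rw [this]
    rw [lintegral_const, mul_comm, Measure.restrict_apply_univ, Real.volume_Icc]
    congr 2; ring
  rw [← e2, e1, ← setLIntegral_const]
  refine (setLIntegral_mono' hG h).trans (setLIntegral_le_lintegral _ _)

end Circle

/-! ### Gaussian measure of the cone `|M| ≤ εT` -/

section Cone

open ProbabilityTheory

variable {ι : Type} [Fintype ι]

/-- The cone on which the form of `M` is dominated by `ε` times the form of `T`. -/
def ratioCone (M T : Matrix ι ι ℝ) (ε : ℝ) : Set (EuclideanSpace ℝ ι) :=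
  {x | 0 < quadForm T x ∧ |quadForm M x| ≤ ε * quadForm T x}

theorem measurableSet_ratioCone (M T : Matrix ι ι ℝ) (ε : ℝ) :
    MeasurableSet (ratioCone M T ε) :=
  (measurableSet_lt measurable_const (measurable_quadForm T)).inter
    (measurableSet_le (measurable_quadForm M).abs ((measurable_quadForm T).const_mul ε))

variable [DecidableEq ι]

/-- Outside the cone one of `M - εT` and `-M - εT` is nonnegative; both have trace `-εn` and are
bounded by `‖x‖²`, so the Chernoff bound applies to each. -/
theorem stdGaussian_ratioCone_ge {M T : Matrix ι ι ℝ} (hM : M.IsHermitian) (hT : T.IsHermitian)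
    (hMtr : M.trace = 0) (hTtr : T.trace = Fintype.card ι)
    (hMb : ∀ x, |quadForm M x| ≤ 1 / 2 * ‖x‖ ^ 2) (hT0 : ∀ x, 0 ≤ quadForm T x)
    {ε : ℝ} (hε0 : 0 ≤ ε) (hε : ε ≤ 1 / 2) (hTb : ∀ x, ε * quadForm T x ≤ 1 / 2 * ‖x‖ ^ 2) :
    1 - 2 * Real.exp (-(ε ^ 2 * Fintype.card ι / 8)) ≤
      (stdGaussian (EuclideanSpace ℝ ι)).real (ratioCone M T ε) := by
  have key : ∀ N : Matrix ι ι ℝ, N.IsHermitian → N.trace = 0 →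
      (∀ x, |quadForm N x| ≤ 1 / 2 * ‖x‖ ^ 2) →
      (stdGaussian (EuclideanSpace ℝ ι)).real {x | 0 ≤ quadForm (N - ε • T) x}
        ≤ Real.exp (-(ε ^ 2 * Fintype.card ι / 8)) := by
    intro N hN hNtr hNb
    have hεT : (ε • T).IsHermitian := by
      rw [Matrix.IsHermitian, Matrix.conjTranspose_smul, hT.eq, star_trivial]
    refine quadForm_nonneg_prob_le (hN.sub hεT) hε0 hε (fun x => ?_) ?_
    · rw [quadForm_sub, quadForm_smul_matrix]
      refine (abs_sub _ _).trans ?_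
      rw [abs_of_nonneg (mul_nonneg hε0 (hT0 x))]
      linarith [hNb x, hTb x]
    · rw [Matrix.trace_sub, Matrix.trace_smul, hNtr, hTtr, smul_eq_mul, zero_sub]
  have h1 := key M hM hMtr hMb
  have h2 := key (-M) hM.neg (by simp [hMtr]) (by simpa [quadForm_neg] using hMb)
  have hsub : (ratioCone M T ε)ᶜ ⊆ {x | 0 ≤ quadForm (M - ε • T) x} ∪
      {x | 0 ≤ quadForm (-M - ε • T) x} := by
    intro x hx
    simp only [Set.mem_union, Set.mem_ofPred_eq, quadForm_sub, quadForm_neg, quadForm_smul_matrix]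
    by_contra! hcon
    refine hx ⟨?_, ?_⟩
    · by_contra! h0
      have : quadForm T x = 0 := le_antisymm h0 (hT0 x)
      rw [this] at hcon
      linarith [hcon.1, hcon.2]
    · rw [abs_le]; constructor <;> linarith [hcon.1, hcon.2]
  have h3 := (measureReal_mono hsub).trans
    (measureReal_union_le (μ := stdGaussian (EuclideanSpace ℝ ι)) _ _)
  rw [measureReal_compl (measurableSet_ratioCone M T ε), probReal_univ] at h3
  linarith

/-- This covers the range where the Chernoff bound can be void. It rests on the change of sign of
`M` along circles, and the length of the good arc makes it linear in `ε√n`. -/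
theorem exists_stdGaussian_ratioCone_small :
    ∃ c : ℝ, 0 < c ∧ ∀ (ι : Type) [Fintype ι] [DecidableEq ι] [Nonempty ι] (M T : Matrix ι ι ℝ),
      M.IsHermitian → T.IsHermitian → M.trace = 0 → T.trace = Fintype.card ι →
      (∀ x, |quadForm M x| ≤ 1 / 2 * ‖x‖ ^ 2) → (∀ x, 0 ≤ quadForm T x) →
      ∀ ε : ℝ, 0 ≤ ε → ε * √(Fintype.card ι) ≤ 8 →
      c * (ε * √(Fintype.card ι)) ≤
        (stdGaussian (EuclideanSpace ℝ ι)).real (ratioCone M T ε) := by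
  obtain ⟨c₀, hc₀, hc₀'⟩ : ∃ c₀ : ℝ, 0 < c₀ ∧ c₀ = 1 / 2000000 := ⟨_, by norm_num, rfl⟩
  -- Three exclusions of `c₀²/24` (angles `0`, `π/2`, `π/4`) remove at most half of the `c₀²/4`
  -- available for pairs of opposite sign.
  obtain ⟨C, hC8, hC⟩ := stdGaussian_abs_quadForm_tail (δ := c₀ ^ 2 / 24) (by positivity)
  -- Makes the small ball bound `2√η` equal to `c₀/2`, half of the sign probability.
  set η : ℝ := (c₀ / 4) ^ 2 with hη
  have hη0 : 0 < η := by positivity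
  have hη1 : η ≤ 1 := by rw [hη, hc₀']; norm_num
  have hpi3 := Real.pi_gt_three
  refine ⟨η / (6 * C) * (c₀ ^ 2 / 8) / Real.pi, by positivity, ?_⟩
  intro ι _ _ _ M T hM hT hMtr hTtr hMb hT0 ε hε0 hε8
  set γ := stdGaussian (EuclideanSpace ℝ ι) with hγ
  set n : ℝ := (Fintype.card ι : ℝ) with hn
  have hn1 : 1 ≤ n := by rw [hn]; exact_mod_cast Fintype.card_pos
  have hsn : 0 < √n := Real.sqrt_pos.2 (by linarith)
  have hsn2 : √n * √n = n := Real.mul_self_sqrt (by linarith)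
  have hmM := measurable_quadForm M
  have hmT := measurable_quadForm T
  -- the half spaces of the form of `M`, away from the degenerate set of `T`
  have hTsmall : γ.real {x | quadForm T x ≤ η * n} ≤ c₀ / 2 := by
    refine (stdGaussian_posSemidef_small_ball hT hT0 hTtr hη0).trans ?_
    rw [hη, Real.sqrt_sq (by positivity)]; linarith
  have hhalf : ∀ N : Matrix ι ι ℝ, N.IsHermitian → N.trace = 0 →
      c₀ / 2 ≤ γ.real {x | 0 ≤ quadForm N x ∧ η * n ≤ quadForm T x} := by
    intro N hN hNtr
    have h1 : c₀ ≤ γ.real {x | 0 ≤ quadForm N x} := by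
      rw [hc₀']; exact stdGaussian_quadForm_nonneg hN hNtr
    have hsub : {x | 0 ≤ quadForm N x} ⊆ {x | 0 ≤ quadForm N x ∧ η * n ≤ quadForm T x} ∪
        {x | quadForm T x ≤ η * n} := by
      intro x hx
      rcases le_total (η * n) (quadForm T x) with h | h
      · exact Or.inl ⟨hx, h⟩
      · exact Or.inr h
    have := (measureReal_mono hsub).trans (measureReal_union_le (μ := γ) _ _)
    linarith
  have hplus := hhalf M hM hMtr
  have hminus := hhalf (-M) hM.neg (by simp [hMtr])
  simp only [quadForm_neg, Left.nonneg_neg_iff] at hminus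
  have hb := hC ι M hM hMtr hMb
  -- good pairs
  set Ap := {x : EuclideanSpace ℝ ι | 0 ≤ quadForm M x ∧ η * n ≤ quadForm T x}
  set Am := {x : EuclideanSpace ℝ ι | quadForm M x ≤ 0 ∧ η * n ≤ quadForm T x}
  set L := C * √n with hL
  have hL0 : 0 < L := by positivity
  set Bd := {x : EuclideanSpace ℝ ι | L ≤ |quadForm M x|}
  have hmAp : MeasurableSet Ap :=
    (measurableSet_le measurable_const hmM).inter (measurableSet_le measurable_const hmT)
  have hmAm : MeasurableSet Am :=
    (measurableSet_le hmM measurable_const).inter (measurableSet_le measurable_const hmT)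
  have hmBd : MeasurableSet Bd := measurableSet_le measurable_const hmM.abs
  set R : ℝ → EuclideanSpace ℝ ι × EuclideanSpace ℝ ι → EuclideanSpace ℝ ι :=
    fun θ p => Real.cos θ • p.1 + Real.sin θ • p.2 with hR
  have hmR : ∀ θ, Measurable (R θ) := fun θ => by rw [hR]; fun_prop
  set G : Set (EuclideanSpace ℝ ι × EuclideanSpace ℝ ι) :=
    (Am ×ˢ Ap) \ ((R 0 ⁻¹' Bd ∪ R (Real.pi / 2) ⁻¹' Bd) ∪ R (Real.pi / 4) ⁻¹' Bd) with hG
  have hmG : MeasurableSet G :=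
    (hmAm.prod hmAp).diff (((hmR _ hmBd).union (hmR _ hmBd)).union (hmR _ hmBd))
  have hRB : ∀ θ, (γ.prod γ).real (R θ ⁻¹' Bd) ≤ c₀ ^ 2 / 24 := by
    intro θ
    rw [← map_measureReal_apply (hmR θ) hmBd, stdGaussian_prod_map_rotation]
    exact hb
  have hGprob : c₀ ^ 2 / 8 ≤ (γ.prod γ).real G := by
    have h1 : c₀ ^ 2 / 4 ≤ (γ.prod γ).real (Am ×ˢ Ap) := by
      rw [measureReal_prod_prod]
      nlinarith
    have h2 := measureReal_union_le (μ := γ.prod γ)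
      (R 0 ⁻¹' Bd ∪ R (Real.pi / 2) ⁻¹' Bd) (R (Real.pi / 4) ⁻¹' Bd)
    have h3 := measureReal_union_le (μ := γ.prod γ) (R 0 ⁻¹' Bd) (R (Real.pi / 2) ⁻¹' Bd)
    have h4 : (γ.prod γ).real (Am ×ˢ Ap) ≤ (γ.prod γ).real G + (γ.prod γ).real
        ((R 0 ⁻¹' Bd ∪ R (Real.pi / 2) ⁻¹' Bd) ∪ R (Real.pi / 4) ⁻¹' Bd) := by
      refine le_trans (measureReal_mono ?_) (measureReal_union_le _ _)
      rw [hG, Set.sdiff_union_self]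
      exact Set.subset_union_left
    linarith [hRB 0, hRB (Real.pi / 2), hRB (Real.pi / 4)]
  -- Chosen so that `6Lδ = εηn`, which is at most `εT` where `T ≥ ηn`.
  set δ := ε * √n * (η / (6 * C)) with hδ
  have hδ0 : 0 ≤ δ := by positivity
  have hδ4 : δ ≤ Real.pi / 4 := by
    have : η / (6 * C) ≤ 1 / 48 := by
      rw [div_le_div_iff₀ (by positivity) (by norm_num)]; nlinarith
    have := mul_le_mul hε8 this (by positivity) (by norm_num)
    linarith
  have hδL : 6 * L * δ = ε * (η * n) := by
    calc 6 * L * δ = ε * (η * (√n * √n)) := by rw [hδ, hL]; field_simp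
      _ = ε * (η * n) := by rw [hsn2]
  have harc : ∀ p ∈ G, ENNReal.ofReal δ ≤
      (volume.restrict (Set.Icc (-(Real.pi / 2)) (Real.pi / 2)))
        {θ | Real.cos θ • p.1 + Real.sin θ • p.2 ∈ ratioCone M T ε} := by
    rintro ⟨x, y⟩ ⟨⟨hx, hy⟩, hnot⟩
    simp only [Set.mem_union, Set.mem_preimage, not_or, hR, Real.cos_zero, Real.sin_zero, one_smul,
      zero_smul, add_zero, Real.cos_pi_div_two, Real.sin_pi_div_two, zero_add, Bd,
      Set.mem_ofPred_eq, not_le] at hnot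
    obtain ⟨⟨hx', hy'⟩, hxy⟩ := hnot
    obtain ⟨a, ha⟩ := exists_interval_circleForm_le (h' := polarForm T x y) hx.1 hy.1 hx'.le hy'.le
      (abs_polarForm_le hM hx'.le hy'.le hxy.le) hx.2 hy.2 hδ0 hδ4
    have hvol : volume (Set.Icc a (a + δ)) = ENNReal.ofReal δ := by
      rw [Real.volume_Icc]; congr 1; ring
    rw [← hvol, Measure.restrict_apply' measurableSet_Icc]
    refine measure_mono fun θ hθ => ?_
    obtain ⟨h1, h2, h3⟩ := ha hθ
    refine ⟨?_, h1⟩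
    rw [← quadForm_circle hT] at h2
    rw [← quadForm_circle hM, hδL] at h3
    refine ⟨lt_of_lt_of_le (by positivity) h2, h3.trans (by gcongr)⟩
  have hfin := mul_prod_le_pi_mul_stdGaussian (measurableSet_ratioCone M T ε) hmG harc
  have hreal : δ * (γ.prod γ).real G ≤ Real.pi * γ.real (ratioCone M T ε) := by
    have := ENNReal.toReal_mono (by finiteness) hfin
    rwa [ENNReal.toReal_mul, ENNReal.toReal_mul, ENNReal.toReal_ofReal hδ0,
      ENNReal.toReal_ofReal Real.pi_pos.le] at this
  have hlow : δ * (c₀ ^ 2 / 8) ≤ Real.pi * γ.real (ratioCone M T ε) :=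
    (mul_le_mul_of_nonneg_left hGprob hδ0).trans hreal
  rw [show η / (6 * C) * (c₀ ^ 2 / 8) / Real.pi * (ε * √n) = δ * (c₀ ^ 2 / 8) / Real.pi by
    rw [hδ]; ring, div_le_iff₀ Real.pi_pos]
  linarith

/-- Lower bound, uniform in the dimension, for the Gaussian measure of `ratioCone`. -/
theorem exists_stdGaussian_ratioCone :
    ∃ κ : ℝ, 0 < κ ∧ ∀ (ι : Type) [Fintype ι] [DecidableEq ι] [Nonempty ι] (M T : Matrix ι ι ℝ),
      M.IsHermitian → T.IsHermitian → M.trace = 0 → T.trace = Fintype.card ι →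
      (∀ x, |quadForm M x| ≤ 1 / 2 * ‖x‖ ^ 2) → (∀ x, 0 ≤ quadForm T x) →
      ∀ ε : ℝ, 0 ≤ ε → ε ≤ 1 / 2 → (∀ x, ε * quadForm T x ≤ 1 / 2 * ‖x‖ ^ 2) →
      (1 - Real.exp (-(κ * Fintype.card ι * ε ^ 2))) ^ 2 ≤
        (stdGaussian (EuclideanSpace ℝ ι)).real (ratioCone M T ε) := by
  obtain ⟨c, hc, hsmall⟩ := exists_stdGaussian_ratioCone_small
  -- For `u = ε√n ≤ 8`, `κ²u⁴ ≤ (1/16)(c/32)·8³u = cu`. For `u ≥ 8`, the bound `κ ≤ 1/16` leaves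
  -- room in `2 exp(-u²/8) ≤ exp(-κu²)` to absorb the factor 2.
  refine ⟨min (1 / 16) (c / 32), by positivity, ?_⟩
  intro ι _ _ _ M T hM hT hMtr hTtr hMb hT0 ε hε0 hε hTb
  set κ := min (1 / 16 : ℝ) (c / 32)
  have hκ0 : 0 < κ := by positivity
  have hκ1 : κ ≤ 1 / 16 := min_le_left _ _
  have hκ2 : κ ≤ c / 32 := min_le_right _ _
  set n : ℝ := (Fintype.card ι : ℝ) with hn
  have hn0 : 0 ≤ n := Nat.cast_nonneg _
  have hq0 := Real.exp_pos (-(κ * n * ε ^ 2))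
  have hq1 : Real.exp (-(κ * n * ε ^ 2)) ≤ 1 :=
    Real.exp_le_one_iff.2 (neg_nonpos.2 (by positivity))
  rcases le_total (ε * √n) 8 with h8 | h8
  · refine le_trans ?_ (hsmall ι M T hM hT hMtr hTtr hMb hT0 ε hε0 h8)
    have hu0 : 0 ≤ ε * √n := by positivity
    have hu2 : n * ε ^ 2 = (ε * √n) ^ 2 := by rw [mul_pow, Real.sq_sqrt hn0, mul_comm]
    rw [mul_assoc, hu2] at hq1 ⊢
    set u := ε * √n
    have h1 : 1 - Real.exp (-(κ * u ^ 2)) ≤ κ * u ^ 2 := by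
      linarith [Real.add_one_le_exp (-(κ * u ^ 2))]
    calc (1 - Real.exp (-(κ * u ^ 2))) ^ 2 ≤ (κ * u ^ 2) ^ 2 :=
          pow_le_pow_left₀ (by linarith) h1 2
      _ = κ * κ * (u ^ 3 * u) := by ring
      _ ≤ 1 / 16 * (c / 32) * (8 ^ 3 * u) := by gcongr
      _ = c * u := by ring
  · refine le_trans ?_ (stdGaussian_ratioCone_ge hM hT hMtr hTtr hMb hT0 hε0 hε hTb)
    have hu2 : 64 ≤ ε ^ 2 * n := by
      have := pow_le_pow_left₀ (by norm_num) h8 2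
      rw [mul_pow, Real.sq_sqrt hn0] at this; linarith
    have h1 : 2 * Real.exp (-(ε ^ 2 * n / 8)) ≤ Real.exp (-(κ * n * ε ^ 2)) := by
      have e2 : (2 : ℝ) ≤ Real.exp 1 := by linarith [Real.add_one_le_exp (1 : ℝ)]
      calc 2 * Real.exp (-(ε ^ 2 * n / 8)) ≤ Real.exp 1 * Real.exp (-(ε ^ 2 * n / 8)) := by gcongr
        _ = Real.exp (1 + -(ε ^ 2 * n / 8)) := (Real.exp_add _ _).symm
        _ ≤ Real.exp (-(κ * n * ε ^ 2)) := by
          rw [Real.exp_le_exp]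
          nlinarith [mul_le_mul_of_nonneg_right hκ1 (by linarith : 0 ≤ ε ^ 2 * n)]
    nlinarith

end Cone

/-! ### From spherically symmetric laws to the Gaussian -/

section Spherical

open ProbabilityTheory

variable {E : Type*} [NormedAddCommGroup E] [InnerProductSpace ℝ E] [FiniteDimensional ℝ E]
  [MeasurableSpace E] [BorelSpace E]

/-- The reflection in the hyperplane orthogonal to `s - t` exchanges `s` and `t`. -/
theorem charFun_eq_of_norm_eq {μ : Measure E} (hμ : ∀ U : E ≃ₗᵢ[ℝ] E, μ.map U = μ) {s t : E}
    (h : ‖s‖ = ‖t‖) : charFun μ s = charFun μ t := by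
  set U : E ≃ₗᵢ[ℝ] E := (ℝ ∙ (s - t))ᗮ.reflection
  have hU : U s = t := Submodule.reflection_sub h
  conv_rhs => rw [← hμ U]
  rw [charFun_apply, charFun_apply, integral_map (by fun_prop) (by fun_prop)]
  congr 1; ext x
  rw [← hU, U.inner_map_map]

/-- A rotation invariant probability measure on the unit sphere is unique. -/
theorem eq_of_map_eq_of_ae_norm_eq_one {μ ν : Measure E} [IsProbabilityMeasure μ]
    [IsProbabilityMeasure ν] (hμ : ∀ U : E ≃ₗᵢ[ℝ] E, μ.map U = μ)
    (hν : ∀ U : E ≃ₗᵢ[ℝ] E, ν.map U = ν) (hμ1 : ∀ᵐ x ∂μ, ‖x‖ = 1) (hν1 : ∀ᵐ x ∂ν, ‖x‖ = 1) :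
    μ = ν := by
  apply Measure.ext_of_charFun
  ext t
  -- The characteristic function is radial, so it may be averaged over directions drawn from the
  -- other measure. The resulting double integral is symmetric in the two measures by Fubini.
  have key : ∀ (μ ν : Measure E) [IsProbabilityMeasure μ] [IsProbabilityMeasure ν],
      (∀ U : E ≃ₗᵢ[ℝ] E, μ.map U = μ) → (∀ᵐ x ∂ν, ‖x‖ = 1) →
      charFun μ t = ∫ y, ∫ x, Complex.exp (inner ℝ x (‖t‖ • y) * Complex.I) ∂μ ∂ν := by
    intro μ ν _ _ hμ hν1
    have : ∀ᵐ y ∂ν, ∫ x, Complex.exp (inner ℝ x (‖t‖ • y) * Complex.I) ∂μ = charFun μ t := by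
      filter_upwards [hν1] with y hy
      rw [← charFun_apply]
      exact charFun_eq_of_norm_eq hμ (by rw [norm_smul, hy, norm_norm, mul_one])
    rw [integral_congr_ae this]; simp
  rw [key μ ν hμ hν1, key ν μ hν hμ1, integral_integral_swap]
  · congr 1; ext x; congr 1; ext y
    rw [real_inner_smul_right, real_inner_smul_right, real_inner_comm]
  · refine (integrable_const (1 : ℝ)).mono' (Continuous.aestronglyMeasurable ?_) ?_
    · simp only [Function.uncurry_def]; fun_prop
    · refine Eventually.of_forall fun p => le_of_eq ?_
      simp only [Function.uncurry_def]
      rw [Complex.norm_exp_ofReal_mul_I]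

/-- A cone depends on directions only, and normalising either measure gives the unique invariant law
on the sphere. -/
theorem measure_cone_eq_stdGaussian {μ : Measure E} [IsProbabilityMeasure μ]
    (hμ : ∀ U : E ≃ₗᵢ[ℝ] E, μ.map U = μ) (hμ0 : μ {0} = 0) [Nontrivial E] {S : Set E}
    (hS : MeasurableSet S) (hcone : ∀ x ∈ S, ∀ c : ℝ, 0 < c → c • x ∈ S) :
    μ S = stdGaussian E S := by
  set N : E → E := fun x => ‖x‖⁻¹ • x
  have hN : Measurable N := by fun_prop
  have key : ∀ (μ : Measure E) [IsProbabilityMeasure μ], (∀ U : E ≃ₗᵢ[ℝ] E, μ.map U = μ) →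
      μ {0} = 0 → IsProbabilityMeasure (μ.map N) ∧ (∀ U : E ≃ₗᵢ[ℝ] E, (μ.map N).map U = μ.map N) ∧
        (∀ᵐ x ∂(μ.map N), ‖x‖ = 1) ∧ μ S = μ.map N S := by
    intro μ _ hμ hμ0
    have hne : ∀ᵐ x ∂μ, x ≠ 0 := by
      rw [ae_iff]; simpa using hμ0
    refine ⟨Measure.isProbabilityMeasure_map hN.aemeasurable, fun U => ?_, ?_, ?_⟩
    · conv_rhs => rw [← hμ U]
      rw [Measure.map_map (by fun_prop) hN, Measure.map_map hN (by fun_prop)]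
      congr 1; ext x
      simp [N]
    · rw [ae_map_iff hN.aemeasurable (measurableSet_eq_fun (by fun_prop) (by fun_prop))]
      filter_upwards [hne] with x hx
      simp [N, norm_smul, hx]
    · rw [Measure.map_apply hN hS]
      refine measure_congr ?_
      filter_upwards [hne] with x hx
      have hp : 0 < ‖x‖ := norm_pos_iff.2 hx
      refine propext ⟨fun h => hcone x h _ (inv_pos.2 hp), fun h => ?_⟩
      have := hcone _ h _ hp
      rw [show ‖x‖ • N x = x by simp [N, smul_smul, hp.ne']] at this
      exact this
  -- A nonzero linear functional has a nondegenerate Gaussian law, which has no atom.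
  have hγ0 : stdGaussian E {(0 : E)} = 0 := by
    obtain ⟨v, hv⟩ := exists_ne (0 : E)
    have hL : (stdGaussian E).map (innerSL ℝ v) {0} = 0 := by
      rw [IsGaussian.map_eq_gaussianReal, variance_dual_stdGaussian]
      have : NullSingletonClass (gaussianReal ((stdGaussian E)[innerSL ℝ v])
          (‖innerSL ℝ v‖ ^ 2).toNNReal) := nullSingletonClass_gaussianReal (by simpa using hv)
      exact measure_singleton _
    rw [Measure.map_apply (by fun_prop) (measurableSet_singleton _)] at hL
    exact measure_mono_null (by intro x hx; simp_all) hL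
  obtain ⟨p1, u1, n1, e1⟩ := key μ hμ hμ0
  obtain ⟨p2, u2, n2, e2⟩ := key (stdGaussian E) (fun U => stdGaussian_map U) hγ0
  rw [e1, e2, eq_of_map_eq_of_ae_norm_eq_one u1 u2 n1 n2]

end Spherical

/-! ### Fourier coefficients on the unit frequency interval -/

section Fourier

open scoped ComplexConjugate

/-- The character `ν ↦ exp(2πiνn)`. -/
noncomputable def freqChar (n : ℤ) (ν : ℝ) : ℂ := Complex.exp (2 * Real.pi * Complex.I * ν * n)

/-- The Fourier coefficient `∫ f(ν) exp(2πiνn) dν` over `[-1/2, 1/2]`. -/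
noncomputable def freqCoeff (f : ℝ → ℂ) (n : ℤ) : ℂ :=
  ∫ ν in (-1 / 2 : ℝ)..(1 / 2), f ν * freqChar n ν

/-- Lebesgue measure on the unit frequency interval. -/
noncomputable def freqMeasure : Measure ℝ := volume.restrict (Set.Ioc (-1 / 2 : ℝ) (1 / 2))

instance : IsFiniteMeasure freqMeasure := by unfold freqMeasure; infer_instance

theorem freqCoeff_eq (f : ℝ → ℂ) (n : ℤ) :
    freqCoeff f n = ∫ ν, f ν * freqChar n ν ∂freqMeasure :=
  intervalIntegral.integral_of_le (by norm_num)

@[fun_prop]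
theorem continuous_freqChar (n : ℤ) : Continuous (freqChar n) := by
  unfold freqChar; fun_prop

theorem freqChar_add (m n : ℤ) (ν : ℝ) : freqChar (m + n) ν = freqChar m ν * freqChar n ν := by
  rw [freqChar, freqChar, freqChar, ← Complex.exp_add]
  congr 1; push_cast; ring

theorem conj_freqChar (n : ℤ) (ν : ℝ) : conj (freqChar n ν) = freqChar (-n) ν := by
  rw [freqChar, freqChar, ← Complex.exp_conj]
  simp only [map_mul, Complex.conj_I, Complex.conj_ofReal, map_ofNat, map_intCast]
  congr 1; push_cast; ring

theorem freqChar_zero (ν : ℝ) : freqChar 0 ν = 1 := by simp [freqChar]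

theorem norm_freqChar (n : ℤ) (ν : ℝ) : ‖freqChar n ν‖ = 1 := by
  rw [freqChar, show (2 * Real.pi * Complex.I * ν * n : ℂ)
    = ((2 * Real.pi * ν * n : ℝ) : ℂ) * Complex.I by push_cast; ring]
  exact Complex.norm_exp_ofReal_mul_I _

theorem freqChar_eq_fourier (n : ℤ) (ν : ℝ) :
    freqChar n ν = fourier (T := 1) n (ν : AddCircle (1 : ℝ)) := by
  rw [fourier_coe_apply, freqChar]
  congr 1; push_cast; ring

theorem freqCoeff_eq_fourierCoeff (f : ℝ → ℂ) (n : ℤ) :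
    freqCoeff f n = fourierCoeff (AddCircle.liftIoc 1 (-1 / 2 : ℝ) f) (-n) := by
  rw [fourierCoeff_eq_intervalIntegral _ _ (-1 / 2 : ℝ), freqCoeff, div_one, one_smul,
    show (-1 / 2 + 1 : ℝ) = 1 / 2 by norm_num, intervalIntegral.integral_of_le (by norm_num),
    intervalIntegral.integral_of_le (by norm_num)]
  refine setIntegral_congr_fun measurableSet_Ioc fun x hx => ?_
  rw [AddCircle.liftIoc_coe_apply (by norm_num at hx ⊢; exact hx), neg_neg, freqChar_eq_fourier,
    smul_eq_mul, mul_comm]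

theorem freqCoeff_mul_freqChar (f : ℝ → ℂ) (k n : ℤ) :
    freqCoeff (fun ν => f ν * freqChar k ν) n = freqCoeff f (k + n) := by
  simp only [freqCoeff, freqChar_add, mul_assoc]

theorem conj_freqCoeff (f : ℝ → ℂ) (n : ℤ) :
    conj (freqCoeff f n) = freqCoeff (fun ν => conj (f ν)) (-n) := by
  rw [freqCoeff_eq, freqCoeff_eq, ← integral_conj]
  simp only [map_mul, conj_freqChar]

/-- Parseval's identity. -/
theorem hasSum_freqCoeff_mul_conj {f g : ℝ → ℂ} (hf : MemLp f 2 freqMeasure)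
    (hg : MemLp g 2 freqMeasure) :
    HasSum (fun n => freqCoeff f n * conj (freqCoeff g n))
      (∫ ν, f ν * conj (g ν) ∂freqMeasure) := by
  have hT : Fact (0 < (1 : ℝ)) := ⟨one_pos⟩
  have h12 : (1 / 2 : ℝ) = -1 / 2 + 1 := by norm_num
  rw [freqMeasure, h12] at hf hg
  have hf' := hf.memLp_liftIoc.haarAddCircle
  have hg' := hg.memLp_liftIoc.haarAddCircle
  have h := (fourierBasis (T := 1)).hasSum_inner_mul_inner hg'.toLp hf'.toLp
  have e : ∀ n, inner ℂ hg'.toLp (fourierBasis n) * inner ℂ (fourierBasis n) hf'.toLp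
      = freqCoeff f (-n) * conj (freqCoeff g (-n)) := by
    intro n
    rw [← inner_conj_symm hg'.toLp, ← HilbertBasis.repr_apply_apply,
      ← HilbertBasis.repr_apply_apply, fourierBasis_repr, fourierBasis_repr,
      fourierCoeff_congr_ae hf'.coeFn_toLp, fourierCoeff_congr_ae hg'.coeFn_toLp,
      freqCoeff_eq_fourierCoeff, freqCoeff_eq_fourierCoeff, neg_neg, mul_comm]
  simp only [e] at h
  have hae : (fun a => inner ℂ ((hg'.toLp _ : Lp ℂ 2 AddCircle.haarAddCircle) a)
      ((hf'.toLp _ : Lp ℂ 2 AddCircle.haarAddCircle) a)) =ᵐ[AddCircle.haarAddCircle]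
      AddCircle.liftIoc 1 (-1 / 2 : ℝ) (fun ν => f ν * conj (g ν)) := by
    filter_upwards [hf'.coeFn_toLp, hg'.coeFn_toLp] with x h1 h2
    rw [h1, h2]; rfl
  have hval : ∫ ν, f ν * conj (g ν) ∂freqMeasure = inner ℂ hg'.toLp hf'.toLp := by
    rw [L2.inner_def, freqMeasure, h12, ← intervalIntegral.integral_of_le (by norm_num),
      ← AddCircle.integral_liftIoc_eq_intervalIntegral, integral_congr_ae hae,
      AddCircle.integral_haarAddCircle, inv_one, one_smul]
  -- `freqCoeff` carries the opposite sign in the exponent from `fourierCoeff`, hence the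
  -- reindexing.
  rw [hval, ← (Equiv.neg ℤ).hasSum_iff]
  exact h

theorem freqCoeff_one (n : ℤ) : freqCoeff (fun _ => 1) n = if n = 0 then 1 else 0 := by
  simp only [freqCoeff, one_mul]
  split_ifs with h
  · subst h
    simp only [freqChar_zero]; norm_num
  · have hc : (2 * Real.pi * Complex.I * n : ℂ) ≠ 0 := by
      simp [Real.pi_ne_zero, Complex.I_ne_zero, h]
    have e : ∀ ν : ℝ, freqChar n ν = Complex.exp ((2 * Real.pi * Complex.I * n : ℂ) * ν) := by
      intro ν; rw [freqChar]; congr 1; ring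
    simp only [e]
    rw [integral_exp_mul_complex hc]
    have : Complex.exp ((2 * Real.pi * Complex.I * n : ℂ) * ((1 / 2 : ℝ) : ℂ))
        = Complex.exp ((2 * Real.pi * Complex.I * n : ℂ) * ((-1 / 2 : ℝ) : ℂ)) := by
      rw [Complex.exp_eq_exp_iff_exists_int]
      exact ⟨n, by push_cast; ring⟩
    rw [this, sub_self, zero_div]

/-- An integrable function on the unit interval is determined by its Fourier coefficients. -/
theorem ae_eq_zero_of_freqCoeff_eq_zero {f : ℝ → ℂ} (hf : Integrable f freqMeasure)
    (h : ∀ n, freqCoeff f n = 0) : f =ᵐ[freqMeasure] 0 := by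
  have hT : Fact (0 < (1 : ℝ)) := ⟨one_pos⟩
  have hint : ∀ G : C(AddCircle (1 : ℝ), ℂ),
      Integrable (fun ν : ℝ => f ν * G (ν : AddCircle (1 : ℝ))) freqMeasure := by
    intro G
    refine hf.mul_bdd (c := ‖G‖) ?_ ?_
    · exact (G.continuous.comp (AddCircle.continuous_mk' 1)).aestronglyMeasurable
    · exact Eventually.of_forall fun ν => G.norm_coe_le_norm _
  -- Integration against `f` is continuous for the uniform norm and kills the characters, whose span
  -- is dense; so it kills all continuous functions on the circle, in particular the periodised bump
  -- functions.
  let Λ : C(AddCircle (1 : ℝ), ℂ) →ₗ[ℂ] ℂ :=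
    { toFun := fun G => ∫ ν, f ν * G (ν : AddCircle (1 : ℝ)) ∂freqMeasure
      map_add' := fun G H => by
        rw [← integral_add (hint G) (hint H)]; simp [mul_add]
      map_smul' := fun c G => by
        simp only [RingHom.id_apply, smul_eq_mul]
        rw [← integral_const_mul]; congr 1; ext ν; simp; ring }
  have hΛc : Continuous Λ := by
    refine (Λ.mkContinuous (∫ ν, ‖f ν‖ ∂freqMeasure) fun G => ?_).continuous
    refine (norm_integral_le_integral_norm _).trans ?_
    rw [← integral_mul_const]
    refine integral_mono (hint G).norm (hf.norm.mul_const _) fun ν => ?_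
    simp only [norm_mul]
    gcongr
    exact G.norm_coe_le_norm _
  have hΛ : ∀ G, Λ G = 0 := by
    have hle : Submodule.span ℂ (Set.range (fourier (T := 1))) ≤ LinearMap.ker Λ := by
      rw [Submodule.span_le]
      rintro _ ⟨n, rfl⟩
      have := h n
      rw [freqCoeff_eq] at this
      simp only [freqChar_eq_fourier] at this
      exact this
    have hcl : IsClosed (LinearMap.ker Λ : Set C(AddCircle (1 : ℝ), ℂ)) :=
      isClosed_singleton.preimage hΛc
    have := Submodule.topologicalClosure_minimal _ hle hcl
    rw [span_fourier_closure_eq_top] at this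
    exact fun G => this (Submodule.mem_top (x := G))
  have hloc : LocallyIntegrableOn f (Set.Ioo (-1 / 2 : ℝ) (1 / 2)) volume := by
    have : IntegrableOn f (Set.Ioc (-1 / 2 : ℝ) (1 / 2)) volume := hf
    exact (this.mono_set Set.Ioo_subset_Ioc_self).locallyIntegrableOn
  have key := isOpen_Ioo.ae_eq_zero_of_integral_contDiff_smul_eq_zero hloc fun g hg _ hsupp => ?_
  · rw [freqMeasure, Filter.EventuallyEq, ← restrict_Ioo_eq_restrict_Ioc,
      ae_restrict_iff' measurableSet_Ioo]
    exact key
  · have h0 : ∀ x, x ∉ Set.Ioo (-1 / 2 : ℝ) (1 / 2) → g x = 0 := fun x hx =>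
      image_eq_zero_of_notMem_tsupport fun hx' => hx (hsupp hx')
    set g' : ℝ → ℂ := fun x => (g x : ℂ)
    have hgc : Continuous g' := Complex.continuous_ofReal.comp hg.continuous
    have hend : g' (-1 / 2) = g' (-1 / 2 + 1) := by
      simp only [g']
      rw [h0 _ (by simp), h0 _ (by norm_num)]
    have hcont := AddCircle.liftIoc_continuous (p := (1 : ℝ)) hend hgc.continuousOn
    have := hΛ ⟨_, hcont⟩
    rw [← this]
    change _ = ∫ ν, f ν * AddCircle.liftIoc 1 (-1 / 2 : ℝ) g' (ν : AddCircle (1 : ℝ)) ∂freqMeasure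
    rw [freqMeasure, ← setIntegral_eq_integral_of_forall_compl_eq_zero
      (s := Set.Ioc (-1 / 2 : ℝ) (1 / 2))]
    · refine setIntegral_congr_fun measurableSet_Ioc fun x hx => ?_
      rw [AddCircle.liftIoc_coe_apply (by norm_num at hx ⊢; exact hx), Complex.real_smul, mul_comm]
    · intro x hx
      rw [h0 x fun hx' => hx (Set.Ioo_subset_Ioc_self hx'), zero_smul]

end Fourier

/-! ### Trigonometric polynomials -/

section Bounded

open scoped ComplexConjugate

theorem memLp_two_freqMeasure_of_bound {f : ℝ → ℂ} (hf : Measurable f) {B : ℝ}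
    (hB : ∀ ν ∈ Set.Icc (-1 / 2 : ℝ) (1 / 2), ‖f ν‖ ≤ B) : MemLp f 2 freqMeasure := by
  refine MemLp.of_bound hf.aestronglyMeasurable B ?_
  rw [freqMeasure, ae_restrict_iff' measurableSet_Ioc]
  exact Eventually.of_forall fun ν hν => hB ν (Set.Ioc_subset_Icc_self hν)

theorem integrable_freqMeasure_of_bound {f : ℝ → ℂ} (hf : Measurable f) {B : ℝ}
    (hB : ∀ ν ∈ Set.Icc (-1 / 2 : ℝ) (1 / 2), ‖f ν‖ ≤ B) : Integrable f freqMeasure :=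
  (memLp_two_freqMeasure_of_bound hf hB).integrable (by norm_num)

/-- The trigonometric polynomial with coefficients `c` and frequencies `τ`. -/
noncomputable def trigPoly {ι : Type*} (F : Finset ι) (c : ι → ℝ) (τ : ι → ℤ) (ν : ℝ) : ℂ :=
  ∑ i ∈ F, (c i : ℂ) * freqChar (τ i) ν

variable {ι : Type*} (F : Finset ι) (c : ι → ℝ) (τ : ι → ℤ)

@[fun_prop]
theorem continuous_trigPoly : Continuous (trigPoly F c τ) := by
  unfold trigPoly; fun_prop

theorem normSq_trigPoly (ν : ℝ) : ((‖trigPoly F c τ ν‖ ^ 2 : ℝ) : ℂ)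
    = ∑ i ∈ F, ∑ j ∈ F, (c i : ℂ) * c j * freqChar (τ i - τ j) ν := by
  rw [Complex.ofReal_pow, ← Complex.mul_conj', trigPoly, map_sum, Finset.sum_mul_sum]
  refine Finset.sum_congr rfl fun i _ => Finset.sum_congr rfl fun j _ => ?_
  rw [map_mul, Complex.conj_ofReal, conj_freqChar, sub_eq_add_neg, freqChar_add]
  ring

theorem norm_trigPoly_le (ν : ℝ) : ‖trigPoly F c τ ν‖ ≤ ∑ i ∈ F, |c i| := by
  refine (norm_sum_le _ _).trans (Finset.sum_le_sum fun i _ => ?_)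
  rw [norm_mul, norm_freqChar, mul_one, Complex.norm_real, Real.norm_eq_abs]

/-- The covariance form of a finite filter: filtering multiplies the spectrum by the squared modulus
of the frequency response. -/
theorem sum_freqCoeff_eq {S : ℝ → ℂ} (hS : Integrable S freqMeasure) (n : ℤ) :
    ∑ i ∈ F, ∑ j ∈ F, (c i : ℂ) * c j * freqCoeff S (n + τ i - τ j)
      = freqCoeff (fun ν => ((‖trigPoly F c τ ν‖ ^ 2 : ℝ) : ℂ) * S ν) n := by
  have hint : ∀ i j, Integrable
      (fun ν => (c i : ℂ) * c j * (S ν * freqChar (n + τ i - τ j) ν)) freqMeasure := by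
    intro i j
    refine Integrable.const_mul (hS.mul_bdd (c := 1)
      (continuous_freqChar _).aestronglyMeasurable ?_) _
    exact Eventually.of_forall fun ν => (norm_freqChar _ _).le
  have hsum : ∫ ν, ∑ i ∈ F, ∑ j ∈ F, (c i : ℂ) * c j * (S ν * freqChar (n + τ i - τ j) ν)
      ∂freqMeasure = ∑ i ∈ F, ∑ j ∈ F, ∫ ν, (c i : ℂ) * c j *
        (S ν * freqChar (n + τ i - τ j) ν) ∂freqMeasure := by
    rw [integral_finsetSum _ fun i _ => integrable_finsetSum _ fun j _ => hint i j]
    exact Finset.sum_congr rfl fun i _ => integral_finsetSum _ fun j _ => hint i j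
  simp only [freqCoeff_eq, ← integral_const_mul]
  rw [← hsum]
  congr 1; ext ν
  rw [normSq_trigPoly, Finset.sum_mul, Finset.sum_mul]
  refine Finset.sum_congr rfl fun i _ => ?_
  rw [Finset.sum_mul, Finset.sum_mul]
  refine Finset.sum_congr rfl fun j _ => ?_
  rw [show n + τ i - τ j = (τ i - τ j) + n by ring, freqChar_add]
  ring

theorem integral_normSq_trigPoly (hτ : Function.Injective τ) :
    ∫ ν, ‖trigPoly F c τ ν‖ ^ 2 ∂freqMeasure = ∑ i ∈ F, c i ^ 2 := by
  classical
  have h := sum_freqCoeff_eq F c τ (S := fun _ => 1) (integrable_const _) 0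
  simp only [freqCoeff_one] at h
  rw [freqCoeff_eq] at h
  simp only [freqChar_zero, mul_one] at h
  rw [integral_complex_ofReal] at h
  apply Complex.ofReal_injective
  rw [← h]
  push_cast
  refine Finset.sum_congr rfl fun i hi => ?_
  simp only [zero_add, mul_ite, mul_one, mul_zero, sub_eq_zero, hτ.eq_iff]
  rw [Finset.sum_ite_eq F i, if_pos hi, sq]

end Bounded

/-! ### Mean square sums of processes with bounded spectrum -/

section Processes

open scoped ComplexConjugate

variable {Ω : Type*} [MeasurableSpace Ω]

/-- `X` is a zero mean stationary process with a bounded measurable spectral density `S`. -/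
structure HasBoundedSpectrum (P : Measure Ω) (X : ℤ → Ω → ℝ) (S : ℝ → ℝ) : Prop where
  memLp : ∀ t, MemLp (X t) 2 P
  mean_zero : ∀ t, ∫ ω, X t ω ∂P = 0
  measurable : Measurable S
  nonneg : ∀ ν, 0 ≤ S ν
  bounded : ∃ B, ∀ ν, S ν ≤ B
  cov : ∀ s t, ((∫ ω, X s ω * X t ω ∂P : ℝ) : ℂ) = freqCoeff (fun ν => (S ν : ℂ)) (t - s)

namespace HasBoundedSpectrum

variable {P : Measure Ω} {X : ℤ → Ω → ℝ} {S : ℝ → ℝ}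

theorem integrable (hX : HasBoundedSpectrum P X S) :
    Integrable (fun ν => (S ν : ℂ)) freqMeasure := by
  obtain ⟨B, hB⟩ := hX.bounded
  refine integrable_freqMeasure_of_bound (Complex.measurable_ofReal.comp hX.measurable)
    (B := B) fun ν _ => ?_
  rw [Complex.norm_real, Real.norm_eq_abs, abs_of_nonneg (hX.nonneg ν)]
  exact hB ν

theorem isWeaklyStationary (hX : HasBoundedSpectrum P X S) : IsWeaklyStationary P X where
  memLp := hX.memLp
  mean_zero := hX.mean_zero
  cov_shift t τ := by
    apply Complex.ofReal_injective
    rw [hX.cov, hX.cov, add_sub_cancel_left, sub_zero]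

theorem autocov_eq (hX : HasBoundedSpectrum P X S) (n : ℤ) :
    (autocov P X n : ℂ) = freqCoeff (fun ν => (S ν : ℂ)) n := by
  rw [autocov, hX.cov, sub_zero]

theorem isSpectralDensity (hX : HasBoundedSpectrum P X S) : IsSpectralDensity P X S where
  stationary := hX.isWeaklyStationary
  integrable := by
    rw [intervalIntegrable_iff_integrableOn_Ioc_of_le (by norm_num)]
    exact hX.integrable.re
  nonneg := Eventually.of_forall fun ν _ => hX.nonneg ν
  fourier := hX.autocov_eq

/-- The elements of `L²(P)` defined by a process. -/
noncomputable def vec (hX : HasBoundedSpectrum P X S) (t : ℤ) : Lp ℝ 2 P := (hX.memLp t).toLp (X t)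

theorem _root_.inner_toLp_toLp {f g : Ω → ℝ} (hf : MemLp f 2 P) (hg : MemLp g 2 P) :
    inner ℝ (hf.toLp f) (hg.toLp g) = ∫ ω, f ω * g ω ∂P := by
  rw [L2.inner_def]
  refine integral_congr_ae ?_
  filter_upwards [hf.coeFn_toLp, hg.coeFn_toLp] with ω h1 h2
  rw [h1, h2, mul_comm]; rfl

theorem inner_vec (hX : HasBoundedSpectrum P X S) (s t : ℤ) :
    ((inner ℝ (hX.vec s) (hX.vec t) : ℝ) : ℂ) = freqCoeff (fun ν => (S ν : ℂ)) (t - s) := by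
  rw [vec, vec, inner_toLp_toLp, hX.cov]

/-- The left side is `∫ |â_F|² S`, and Parseval evaluates `∫ |â_F|²`. Square summability of `a` is
therefore enough for mean square convergence. -/
theorem norm_sq_sum_vec_le (hX : HasBoundedSpectrum P X S) {B : ℝ} (hB : ∀ ν, S ν ≤ B)
    (a : ℤ → ℝ) (t : ℤ) (F : Finset ℤ) :
    ‖∑ τ ∈ F, a τ • hX.vec (t - τ)‖ ^ 2 ≤ B * ∑ τ ∈ F, a τ ^ 2 := by
  have h1 : ((‖∑ τ ∈ F, a τ • hX.vec (t - τ)‖ ^ 2 : ℝ) : ℂ)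
      = ((∫ ν, ‖trigPoly F a id ν‖ ^ 2 * S ν ∂freqMeasure : ℝ) : ℂ) := by
    rw [← real_inner_self_eq_norm_sq, sum_inner]
    simp only [inner_sum, real_inner_smul_left, real_inner_smul_right]
    push_cast
    simp only [hX.inner_vec]
    have h := sum_freqCoeff_eq F a id hX.integrable 0
    rw [freqCoeff_eq] at h
    simp only [freqChar_zero, mul_one, ← Complex.ofReal_mul] at h
    rw [integral_complex_ofReal] at h
    rw [← h]
    push_cast
    refine Finset.sum_congr rfl fun i _ => Finset.sum_congr rfl fun j _ => ?_
    simp only [id]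
    rw [show t - j - (t - i) = 0 + i - j by ring]
    ring
  have h1' := Complex.ofReal_injective h1
  rw [h1', ← integral_normSq_trigPoly F a id Function.injective_id, ← integral_const_mul]
  have hi : Integrable (fun ν => ‖trigPoly F a id ν‖ ^ 2) freqMeasure := by
    refine Integrable.of_bound (by fun_prop) ((∑ i ∈ F, |a i|) ^ 2)
      (Eventually.of_forall fun ν => ?_)
    rw [Real.norm_eq_abs, abs_pow, abs_norm]
    exact pow_le_pow_left₀ (norm_nonneg _) (norm_trigPoly_le _ _ _ _) 2
  refine integral_mono_of_nonneg (Eventually.of_forall fun ν =>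
    mul_nonneg (sq_nonneg _) (hX.nonneg ν)) (hi.const_mul B) (Eventually.of_forall fun ν => ?_)
  simp only
  rw [mul_comm]
  exact mul_le_mul_of_nonneg_right (hB ν) (sq_nonneg _)

theorem summable_vec (hX : HasBoundedSpectrum P X S) {a : ℤ → ℝ}
    (ha : Summable fun τ => a τ ^ 2) (t : ℤ) : Summable fun τ => a τ • hX.vec (t - τ) := by
  obtain ⟨B, hB⟩ := hX.bounded
  have hB1 : ∀ ν, S ν ≤ |B| + 1 := fun ν => (hB ν).trans (by linarith [le_abs_self B])
  have hB0 : 0 < |B| + 1 := by positivity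
  rw [summable_iff_vanishing_norm] at ha ⊢
  intro e he
  obtain ⟨s, hs⟩ := ha (e ^ 2 / (|B| + 1)) (by positivity)
  refine ⟨s, fun F hF => ?_⟩
  have h1 := hX.norm_sq_sum_vec_le hB1 a t F
  have h2 := (le_abs_self _).trans_lt (hs F hF)
  rw [lt_div_iff₀ hB0] at h2
  exact lt_of_pow_lt_pow_left₀ 2 he.le (by linarith)

/-- Moves mean square convergence into the Hilbert space `L²(P)`, where limits pass through inner
products. -/
theorem isMeanSquareOutput_iff (hX : HasBoundedSpectrum P X S) {a : ℤ → ℝ} {t : ℤ} {Z : Ω → ℝ} :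
    IsMeanSquareOutput P a X t Z ↔
      ∃ hZ : MemLp Z 2 P, HasSum (fun τ => a τ • hX.vec (t - τ)) (hZ.toLp Z) := by
  have key : ∀ hZ : MemLp Z 2 P, ∀ F : Finset ℤ,
      eLpNorm (fun ω => Z ω - ∑ τ ∈ F, a τ * X (t - τ) ω) 2 P
        = edist (∑ τ ∈ F, a τ • hX.vec (t - τ)) (hZ.toLp Z) := by
    intro hZ F
    rw [edist_comm, edist_eq_enorm_sub, Lp.enorm_def]
    refine eLpNorm_congr_ae ?_
    have h1 : ∀ᵐ ω ∂P, ∀ τ ∈ F, (a τ • hX.vec (t - τ)) ω = a τ * X (t - τ) ω := by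
      refine (eventually_all_finset F).2 fun τ _ => ?_
      filter_upwards [Lp.coeFn_smul (a τ) (hX.vec (t - τ)), (hX.memLp (t - τ)).coeFn_toLp]
        with ω h1 h2
      rw [h1, Pi.smul_apply, vec, h2, smul_eq_mul]
    filter_upwards [h1, hZ.coeFn_toLp, Lp.coeFn_sub (hZ.toLp Z) (∑ τ ∈ F, a τ • hX.vec (t - τ)),
      Lp.coeFn_fun_finsetSum F fun τ => a τ • hX.vec (t - τ)] with ω h1 h2 h3 h4
    rw [h3, Pi.sub_apply, h2, h4, Finset.sum_congr rfl h1]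
  constructor
  · rintro ⟨hZ, h⟩
    refine ⟨hZ, ?_⟩
    rw [HasSum, SummationFilter.unconditional_filter, tendsto_iff_edist_tendsto_0]
    simpa only [key hZ] using h
  · rintro ⟨hZ, h⟩
    refine ⟨hZ, ?_⟩
    rw [HasSum, SummationFilter.unconditional_filter, tendsto_iff_edist_tendsto_0] at h
    simpa only [key hZ] using h

theorem exists_isMeanSquareOutput (hX : HasBoundedSpectrum P X S) {a : ℤ → ℝ}
    (ha : Summable fun τ => a τ ^ 2) (t : ℤ) : ∃ Z, IsMeanSquareOutput P a X t Z := by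
  refine ⟨(∑' τ, a τ • hX.vec (t - τ) : Lp ℝ 2 P), hX.isMeanSquareOutput_iff.2 ⟨Lp.memLp _, ?_⟩⟩
  rw [Lp.toLp_coeFn]
  exact (hX.summable_vec ha t).hasSum

theorem isMeanSquareOutput_meanSquareOutput (hX : HasBoundedSpectrum P X S) {a : ℤ → ℝ}
    (ha : Summable fun τ => a τ ^ 2) (t : ℤ) :
    IsMeanSquareOutput P a X t (meanSquareOutput P a X t) := by
  have h := hX.exists_isMeanSquareOutput ha t
  rw [meanSquareOutput, dif_pos h]
  exact h.choose_spec

end HasBoundedSpectrum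

end Processes

/-! ### Spectra of filtered and decimated processes -/

section Outputs

open scoped ComplexConjugate

variable {Ω : Type*} [MeasurableSpace Ω] {P : Measure Ω} {X : ℤ → Ω → ℝ} {S : ℝ → ℝ}
  {a : ℤ → ℝ} {A : ℝ → ℂ}

theorem summable_sq_of_eq_freqCoeff (hA : MemLp A 2 freqMeasure)
    (haA : ∀ n, (a n : ℂ) = freqCoeff A n) : Summable fun n => a n ^ 2 := by
  have h := (hasSum_freqCoeff_mul_conj hA hA).summable
  simp only [← haA, Complex.conj_ofReal, ← Complex.ofReal_mul] at h
  simpa only [sq] using Complex.summable_ofReal.1 h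

namespace HasBoundedSpectrum

/-- The inner product passes through the sum, and Parseval for `S` times a character against `A`
evaluates the series. -/
theorem inner_output_vec (hX : HasBoundedSpectrum P X S) (hAm : Measurable A)
    (hA1 : ∀ ν ∈ Set.Icc (-1 / 2 : ℝ) (1 / 2), ‖A ν‖ ≤ 1)
    (haA : ∀ n, (a n : ℂ) = freqCoeff A n) {s : ℤ} {z : Lp ℝ 2 P}
    (hz : HasSum (fun τ => a τ • hX.vec (s - τ)) z) (u : ℤ) :
    ((inner ℝ z (hX.vec u) : ℝ) : ℂ)
      = freqCoeff (fun ν => S ν * conj (A ν)) (u - s) := by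
  have hAL := memLp_two_freqMeasure_of_bound hAm hA1
  obtain ⟨B, hB⟩ := hX.bounded
  have hSm : Measurable fun ν => (S ν : ℂ) := Complex.measurable_ofReal.comp hX.measurable
  have hSL : MemLp (fun ν => (S ν : ℂ) * freqChar (u - s) ν) 2 freqMeasure := by
    refine memLp_two_freqMeasure_of_bound
      (hSm.mul (continuous_freqChar _).measurable) (B := B) fun ν _ => ?_
    rw [norm_mul, norm_freqChar, mul_one, Complex.norm_real, Real.norm_eq_abs,
      abs_of_nonneg (hX.nonneg ν)]
    exact hB ν
  have h1 : HasSum (fun τ => ((inner ℝ (a τ • hX.vec (s - τ)) (hX.vec u) : ℝ) : ℂ))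
      ((inner ℝ z (hX.vec u) : ℝ) : ℂ) := by
    have := hz.mapL (innerSL ℝ (hX.vec u))
    have h' : HasSum (fun τ => inner ℝ (a τ • hX.vec (s - τ)) (hX.vec u))
        (inner ℝ z (hX.vec u)) := by
      rw [← real_inner_comm z]
      refine this.congr_fun fun τ => ?_
      rw [real_inner_comm]; rfl
    exact Complex.hasSum_ofReal.2 h'
  have h2 := hasSum_freqCoeff_mul_conj hSL hAL
  have e : ∀ τ, ((inner ℝ (a τ • hX.vec (s - τ)) (hX.vec u) : ℝ) : ℂ)
      = freqCoeff (fun ν => (S ν : ℂ) * freqChar (u - s) ν) τ * conj (freqCoeff A τ) := by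
    intro τ
    rw [real_inner_smul_left, Complex.ofReal_mul, hX.inner_vec, freqCoeff_mul_freqChar, ← haA,
      Complex.conj_ofReal, mul_comm]
    congr 2; ring
  simp only [e] at h1
  rw [h1.unique h2, freqCoeff_eq]
  congr 1; ext ν; ring

theorem inner_output_output (hX : HasBoundedSpectrum P X S) (hAm : Measurable A)
    (hA1 : ∀ ν ∈ Set.Icc (-1 / 2 : ℝ) (1 / 2), ‖A ν‖ ≤ 1)
    (haA : ∀ n, (a n : ℂ) = freqCoeff A n) {s t : ℤ} {z w : Lp ℝ 2 P}
    (hz : HasSum (fun τ => a τ • hX.vec (s - τ)) z)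
    (hw : HasSum (fun τ => a τ • hX.vec (t - τ)) w) :
    ((inner ℝ z w : ℝ) : ℂ)
      = freqCoeff (fun ν => ((S ν * ‖A ν‖ ^ 2 : ℝ) : ℂ)) (t - s) := by
  have hAL := memLp_two_freqMeasure_of_bound hAm hA1
  obtain ⟨B, hB⟩ := hX.bounded
  have hSm : Measurable fun ν => (S ν : ℂ) := Complex.measurable_ofReal.comp hX.measurable
  have hSL : MemLp (fun ν => (S ν : ℂ) * A ν * freqChar (s - t) ν) 2 freqMeasure := by
    refine memLp_two_freqMeasure_of_bound
      ((hSm.mul hAm).mul (continuous_freqChar _).measurable) (B := B * 1) fun ν hν => ?_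
    rw [norm_mul, norm_freqChar, mul_one, norm_mul, Complex.norm_real, Real.norm_eq_abs,
      abs_of_nonneg (hX.nonneg ν)]
    exact mul_le_mul (hB ν) (hA1 ν hν) (norm_nonneg _) ((hX.nonneg ν).trans (hB ν))
  have h1 : HasSum (fun τ => ((inner ℝ z (a τ • hX.vec (t - τ)) : ℝ) : ℂ))
      ((inner ℝ z w : ℝ) : ℂ) := by
    have := hw.mapL (innerSL ℝ z)
    exact Complex.hasSum_ofReal.2 this
  have h2 := hasSum_freqCoeff_mul_conj hSL hAL
  have e : ∀ τ, ((inner ℝ z (a τ • hX.vec (t - τ)) : ℝ) : ℂ)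
      = freqCoeff (fun ν => (S ν : ℂ) * A ν * freqChar (s - t) ν) τ * conj (freqCoeff A τ) := by
    intro τ
    rw [real_inner_smul_right, Complex.ofReal_mul, freqCoeff_mul_freqChar, ← haA,
      Complex.conj_ofReal, mul_comm]
    congr 1
    rw [← Complex.conj_ofReal, hX.inner_output_vec hAm hA1 haA hz, conj_freqCoeff]
    simp only [map_mul, Complex.conj_ofReal, Complex.conj_conj]
    congr 1; ring
  simp only [e] at h1
  rw [← Complex.conj_ofReal, h1.unique h2, ← integral_conj, freqCoeff_eq]
  congr 1; ext ν
  simp only [map_mul, Complex.conj_conj, Complex.conj_ofReal, conj_freqChar, neg_sub]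
  push_cast
  rw [← Complex.mul_conj']
  ring

theorem meanSquareOutput_hasBoundedSpectrum [IsProbabilityMeasure P]
    (hX : HasBoundedSpectrum P X S) (hAm : Measurable A)
    (hA1 : ∀ ν ∈ Set.Icc (-1 / 2 : ℝ) (1 / 2), ‖A ν‖ ≤ 1)
    (haA : ∀ n, (a n : ℂ) = freqCoeff A n) :
    (∀ t, MemLp (meanSquareOutput P a X t) 2 P) ∧
    (∀ t, ∫ ω, meanSquareOutput P a X t ω ∂P = 0) ∧
    ∀ s t, ((∫ ω, meanSquareOutput P a X s ω * meanSquareOutput P a X t ω ∂P : ℝ) : ℂ)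
      = freqCoeff (fun ν => ((S ν * ‖A ν‖ ^ 2 : ℝ) : ℂ)) (t - s) := by
  have hsq := summable_sq_of_eq_freqCoeff (memLp_two_freqMeasure_of_bound hAm hA1) haA
  have hZ := fun t => hX.isMeanSquareOutput_iff.1 (hX.isMeanSquareOutput_meanSquareOutput hsq t)
  choose hmem hsum using hZ
  refine ⟨hmem, fun t => ?_, fun s t => ?_⟩
  -- The mean is the inner product with the constant 1, hence continuous in `L²`.
  · have h1 : MemLp (fun _ : Ω => (1 : ℝ)) 2 P := memLp_const 1
    have hz : ∀ {f : Ω → ℝ} (hf : MemLp f 2 P), inner ℝ (h1.toLp _) (hf.toLp f) = ∫ ω, f ω ∂P := by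
      intro f hf
      rw [inner_toLp_toLp]; simp
    have h2 := (hsum t).mapL (innerSL ℝ (h1.toLp _))
    simp only [innerSL_apply_apply, real_inner_smul_right, hz, vec, hX.mean_zero, mul_zero] at h2
    exact h2.unique hasSum_zero
  · rw [← inner_toLp_toLp (hmem s) (hmem t)]
    exact hX.inner_output_output hAm hA1 haA (hsum s) (hsum t)

/-- Nothing is aliased: the retained band, stretched by `D`, fills the unit interval exactly once,
with Jacobian `1/D`. -/
theorem _root_.freqCoeff_band (S : ℝ → ℝ) {D : ℕ} (hD : 1 ≤ D)
    (hA : ∀ ν : ℝ, |ν| ≤ 1 / 2 → ‖A ν‖ = if |ν| < 1 / (2 * (D : ℝ)) then 1 else 0) (n : ℤ) :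
    freqCoeff (fun ν => ((S ν * ‖A ν‖ ^ 2 : ℝ) : ℂ)) (n * D)
      = freqCoeff (fun ν => ((S (ν / D) / D : ℝ) : ℂ)) n := by
  have hD0 : (1 : ℝ) ≤ D := by exact_mod_cast hD
  have hDne : (D : ℝ) ≠ 0 := by positivity
  have hDc : (D : ℂ) ≠ 0 := by exact_mod_cast hDne
  set r : ℝ := 1 / (2 * (D : ℝ)) with hr
  have hr0 : 0 < r := by positivity
  have hr1 : r ≤ 1 / 2 := by
    rw [hr, div_le_div_iff₀ (by positivity) (by norm_num)]; linarith
  set f : ℝ → ℂ := fun ν => (S ν : ℂ) * freqChar (n * D) ν with hf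
  have hL : freqCoeff (fun ν => ((S ν * ‖A ν‖ ^ 2 : ℝ) : ℂ)) (n * D) = ∫ ν in (-r)..r, f ν := by
    rw [freqCoeff, intervalIntegral.integral_of_le (by norm_num),
      intervalIntegral.integral_of_le (by linarith),
      ← setIntegral_congr_set (Ioo_ae_eq_Ioc (a := -r) (b := r))]
    have hind : ∀ ν ∈ Set.Ioc (-1 / 2 : ℝ) (1 / 2),
        ((S ν * ‖A ν‖ ^ 2 : ℝ) : ℂ) * freqChar (n * D) ν = (Set.Ioo (-r) r).indicator f ν := by
      intro ν hν
      rw [hA ν (abs_le.2 ⟨by linarith [hν.1], hν.2⟩)]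
      by_cases h : |ν| < r
      · rw [if_pos h, Set.indicator_of_mem (show ν ∈ Set.Ioo (-r) r from abs_lt.1 h)]; simp [hf]
      · rw [if_neg h, Set.indicator_of_notMem (show ν ∉ Set.Ioo (-r) r from fun h' => h (abs_lt.2 h'))]; simp
    rw [setIntegral_congr_fun measurableSet_Ioc hind, setIntegral_indicator measurableSet_Ioo,
      Set.inter_eq_self_of_subset_right]
    intro ν hν
    exact ⟨by linarith [hν.1], by linarith [hν.2]⟩
  rw [hL, freqCoeff]
  have hsub := intervalIntegral.integral_comp_div (a := -1 / 2) (b := 1 / 2) f hDne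
  rw [show (-1 / 2 : ℝ) / D = -r by rw [hr]; field_simp,
    show (1 / 2 : ℝ) / D = r by rw [hr]; field_simp] at hsub
  have hconv : ∀ ν : ℝ, ((S (ν / D) / D : ℝ) : ℂ) * freqChar n ν = (D : ℂ)⁻¹ * f (ν / D) := by
    intro ν
    have : freqChar (n * D) (ν / D) = freqChar n ν := by
      rw [freqChar, freqChar]; congr 1; push_cast; field_simp
    rw [hf]
    simp only [this]
    push_cast; field_simp
  simp only [hconv]
  rw [intervalIntegral.integral_const_mul, hsub, Complex.real_smul, Complex.ofReal_natCast,
    inv_mul_cancel_left₀ hDc]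

theorem downsample [IsProbabilityMeasure P] (hX : HasBoundedSpectrum P X S) {D : ℕ} (hD : 1 ≤ D)
    (ha : IsIdealAntiAliasing D a) :
    HasBoundedSpectrum P (downsample P a D X) (fun ν => S (ν / D) / D) := by
  obtain ⟨A, hAm, hA, haA⟩ := ha
  have hA1 : ∀ ν ∈ Set.Icc (-1 / 2 : ℝ) (1 / 2), ‖A ν‖ ≤ 1 := by
    intro ν hν
    rw [hA ν (abs_le.2 ⟨by linarith [hν.1], hν.2⟩)]
    split_ifs <;> norm_num
  obtain ⟨h1, h2, h3⟩ := hX.meanSquareOutput_hasBoundedSpectrum hAm hA1 haA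
  obtain ⟨B, hB⟩ := hX.bounded
  exact
    { memLp := fun t => h1 _
      mean_zero := fun t => h2 _
      measurable := (hX.measurable.comp (measurable_id.div_const _)).div_const _
      nonneg := fun ν => div_nonneg (hX.nonneg _) (Nat.cast_nonneg _)
      bounded := ⟨B / D, fun ν => by gcongr; exact hB _⟩
      cov := fun s t => by
        rw [← freqCoeff_band S hD hA, sub_mul]
        exact h3 _ _ }

theorem downsampleWellDefined [IsProbabilityMeasure P] (hX : HasBoundedSpectrum P X S) {D : ℕ}
    (hD : 1 ≤ D) (ha : IsIdealAntiAliasing D a) : DownsampleWellDefined P a D X := by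
  refine ⟨?_, _, (hX.downsample hD ha).isSpectralDensity⟩
  obtain ⟨A, hAm, hA, haA⟩ := ha
  refine hX.exists_isMeanSquareOutput
    (summable_sq_of_eq_freqCoeff (memLp_two_freqMeasure_of_bound hAm (B := 1) ?_) haA)
  intro ν hν
  rw [hA ν (abs_le.2 ⟨by linarith [hν.1], hν.2⟩)]
  split_ifs <;> norm_num

/-- The density selected by choice shares its Fourier coefficients with `S`. Almost everywhere
equality suffices, since the ratio only uses integrals. -/
theorem spectralDensity_ae_eq (hX : HasBoundedSpectrum P X S) :
    spectralDensity P X =ᵐ[freqMeasure] S := by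
  have h : ∃ S, IsSpectralDensity P X S := ⟨S, hX.isSpectralDensity⟩
  have hspec : IsSpectralDensity P X (spectralDensity P X) := by
    rw [spectralDensity, dif_pos h]; exact h.choose_spec
  set S' := spectralDensity P X
  have hi' : Integrable (fun ν => (S' ν : ℂ)) freqMeasure := by
    have := hspec.integrable
    rw [intervalIntegrable_iff_integrableOn_Ioc_of_le (by norm_num)] at this
    exact Integrable.ofReal this
  have key := ae_eq_zero_of_freqCoeff_eq_zero (hi'.sub hX.integrable) fun n => by
    have h1 : freqCoeff (fun ν => (S' ν : ℂ)) n = freqCoeff (fun ν => (S ν : ℂ)) n := by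
      rw [← hX.autocov_eq, hspec.fourier]; rfl
    have hint : ∀ {g : ℝ → ℂ}, Integrable g freqMeasure →
        Integrable (fun ν => g ν * freqChar n ν) freqMeasure := fun hg =>
      hg.mul_bdd (c := 1) (continuous_freqChar _).aestronglyMeasurable
        (Eventually.of_forall fun ν => (norm_freqChar _ _).le)
    rw [freqCoeff_eq, freqCoeff_eq] at h1
    rw [freqCoeff_eq]
    simp only [Pi.sub_apply, sub_mul]
    rw [integral_sub (hint hi') (hint hX.integrable), h1, sub_self]
  filter_upwards [key] with ν hν
  simpa [sub_eq_zero] using hν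

/-- A finite linear combination of shifts of a process. -/
theorem fir [IsProbabilityMeasure P] (hX : HasBoundedSpectrum P X S) {m : ℕ} (k : ℤ) (b : EuclideanSpace ℝ (Fin m)) :
    HasBoundedSpectrum P (filterOutput (firResponse k b) X)
      (fun ν => ‖trigPoly Finset.univ (fun i => b i) (fun i : Fin m => ((i : ℕ) : ℤ)) ν‖ ^ 2
        * S ν) := by
  have hY : ∀ t ω, filterOutput (firResponse k b) X t ω
      = ∑ i : Fin m, b i * X (t - (k + (i : ℕ))) ω := by
    intro t ω
    rw [filterOutput]
    simp only [firResponse, Finset.sum_mul]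
    have hz : ∀ i : Fin m, ∀ τ, τ ≠ k + ((i : ℕ) : ℤ) →
        (if τ = k + ((i : ℕ) : ℤ) then b i else 0) * X (t - τ) ω = 0 := by
      intro i τ hτ; rw [if_neg hτ, zero_mul]
    rw [Summable.tsum_finsetSum fun i _ => (hasSum_single _ (hz i)).summable]
    refine Finset.sum_congr rfl fun i _ => ?_
    rw [tsum_eq_single _ (hz i), if_pos rfl]
  have hmem : ∀ t, MemLp (filterOutput (firResponse k b) X t) 2 P := by
    intro t
    rw [show filterOutput (firResponse k b) X t
      = fun ω => ∑ i : Fin m, b i * X (t - (k + (i : ℕ))) ω from funext (hY t)]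
    exact memLp_finsetSum _ fun i _ => (hX.memLp _).const_mul _
  have hint : ∀ s t, Integrable (fun ω => X s ω * X t ω) P := fun s t =>
    (hX.memLp s).integrable_mul (hX.memLp t)
  obtain ⟨B, hB⟩ := hX.bounded
  refine
    { memLp := hmem
      mean_zero := fun t => ?_
      measurable := ((continuous_trigPoly _ _ _).norm.pow 2).measurable.mul hX.measurable
      nonneg := fun ν => mul_nonneg (sq_nonneg _) (hX.nonneg ν)
      bounded := ⟨(∑ i : Fin m, |b i|) ^ 2 * B, fun ν => ?_⟩
      cov := fun s t => ?_ }
  · simp only [hY]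
    rw [integral_finsetSum _ fun i _ => ((hX.memLp _).integrable (by norm_num)).const_mul _]
    simp [integral_const_mul, hX.mean_zero]
  · exact mul_le_mul (pow_le_pow_left₀ (norm_nonneg _) (norm_trigPoly_le _ _ _ _) 2) (hB ν)
      (hX.nonneg ν) (by positivity)
  · have hprod : ∀ ω, filterOutput (firResponse k b) X s ω * filterOutput (firResponse k b) X t ω
        = ∑ i : Fin m, ∑ j : Fin m, b i * b j *
          (X (s - (k + (i : ℕ))) ω * X (t - (k + (j : ℕ))) ω) := by
      intro ω
      rw [hY, hY, Finset.sum_mul_sum]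
      exact Finset.sum_congr rfl fun i _ => Finset.sum_congr rfl fun j _ => by ring
    simp only [hprod]
    rw [integral_finsetSum _ fun i _ => integrable_finsetSum _ fun j _ => (hint _ _).const_mul _]
    have hin : ∀ i : Fin m, ∫ ω, ∑ j : Fin m, b i * b j *
          (X (s - (k + (i : ℕ))) ω * X (t - (k + (j : ℕ))) ω) ∂P = ∑ j : Fin m, b i * b j *
          ∫ ω, X (s - (k + (i : ℕ))) ω * X (t - (k + (j : ℕ))) ω ∂P := by
      intro i
      rw [integral_finsetSum _ fun j _ => (hint _ _).const_mul _]
      simp only [integral_const_mul]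
    simp only [hin]
    push_cast
    simp only [hX.cov]
    -- The delay `k` cancels in the time differences, so the gain involves only the indices `0, …,
    -- m-1`.
    have h := sum_freqCoeff_eq Finset.univ (fun i => b i) (fun i : Fin m => ((i : ℕ) : ℤ))
      hX.integrable (t - s)
    push_cast at h
    rw [← h]
    refine Finset.sum_congr rfl fun i _ => Finset.sum_congr rfl fun j _ => ?_
    congr 2; ring

end HasBoundedSpectrum

end Outputs

/-! ### The density of a process with summable autocovariance -/

section Psd

open scoped ComplexConjugate

variable {Ω : Type*} [MeasurableSpace Ω] {P : Measure Ω} {X : ℤ → Ω → ℝ}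

theorem dtft_eq_tsum_freqChar (c : ℤ → ℝ) (ν : ℝ) :
    dtft c ν = ∑' t : ℤ, (c t : ℂ) * freqChar (-t) ν := by
  rw [dtft]
  congr 1; ext t; rw [freqChar]; congr 2; push_cast; ring

theorem norm_mul_freqChar (c : ℝ) (n : ℤ) (ν : ℝ) : ‖(c : ℂ) * freqChar n ν‖ = |c| := by
  rw [norm_mul, norm_freqChar, mul_one, Complex.norm_real, Real.norm_eq_abs]

theorem continuous_dtft {c : ℤ → ℝ} (hc : Summable fun t => |c t|) : Continuous (dtft c) := by
  simp only [funext (dtft_eq_tsum_freqChar c)]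
  exact continuous_tsum (fun t => by fun_prop) hc fun t ν => (norm_mul_freqChar _ _ _).le

theorem norm_dtft_le {c : ℤ → ℝ} (hc : Summable fun t => |c t|) (ν : ℝ) :
    ‖dtft c ν‖ ≤ ∑' t, |c t| := by
  rw [dtft_eq_tsum_freqChar]
  exact tsum_of_norm_bounded hc.hasSum fun t => (norm_mul_freqChar _ _ _).le

theorem freqCoeff_dtft {c : ℤ → ℝ} (hc : Summable fun t => |c t|) (n : ℤ) :
    freqCoeff (dtft c) n = c n := by
  have hone : freqMeasure.real Set.univ = 1 := by
    rw [freqMeasure, measureReal_restrict_apply_univ, Real.volume_real_Ioc]; norm_num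
  have hF : ∀ t : ℤ, ∀ ν, ‖(c t : ℂ) * freqChar (n - t) ν‖ = |c t| := fun t ν =>
    norm_mul_freqChar _ _ _
  have hsum := hasSum_integral_of_summable_integral_norm (μ := freqMeasure)
    (F := fun (t : ℤ) ν => (c t : ℂ) * freqChar (n - t) ν)
    (fun t => Integrable.of_bound (by fun_prop) |c t|
      (Eventually.of_forall fun ν => (hF t ν).le))
    (by simpa only [hF, integral_const, hone, one_smul] using hc)
  have e1 : ∀ t, ∫ ν, (c t : ℂ) * freqChar (n - t) ν ∂freqMeasure = if t = n then (c n : ℂ) else 0 := by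
    intro t
    rw [integral_const_mul]
    have := freqCoeff_one (n - t)
    rw [freqCoeff_eq] at this
    simp only [one_mul] at this
    rw [this]
    by_cases h : t = n
    · simp [h]
    · rw [if_neg h, if_neg (fun h' => h (by linarith)), mul_zero]
  simp only [e1] at hsum
  have h2 := hsum.unique (hasSum_ite_eq n (c n : ℂ))
  rw [freqCoeff_eq, ← h2]
  congr 1; ext ν
  rw [dtft_eq_tsum_freqChar, ← tsum_mul_right]
  congr 1; ext t
  rw [mul_assoc, ← freqChar_add]
  congr 2; ring

theorem IsWeaklyStationary.autocov_neg (hX : IsWeaklyStationary P X) (n : ℤ) :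
    autocov P X (-n) = autocov P X n := by
  have := hX.cov_shift (-n) n
  rw [neg_add_cancel] at this
  rw [autocov, autocov, ← this]
  congr 1; ext ω; ring

theorem conj_dtft (c : ℤ → ℝ) (ν : ℝ) : conj (dtft c ν) = dtft c (-ν) := by
  rw [dtft_eq_tsum_freqChar, dtft_eq_tsum_freqChar, Complex.conj_tsum]
  congr 1; ext t
  rw [map_mul, Complex.conj_ofReal, conj_freqChar, freqChar, freqChar]
  congr 2; push_cast; ring

theorem dtft_neg {c : ℤ → ℝ} (hc : ∀ n, c (-n) = c n) (ν : ℝ) : dtft c (-ν) = dtft c ν := by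
  rw [dtft_eq_tsum_freqChar, dtft_eq_tsum_freqChar, ← (Equiv.neg ℤ).tsum_eq]
  congr 1; ext t
  rw [Equiv.neg_apply, hc, freqChar, freqChar]
  congr 2; push_cast; ring

theorem ofReal_psd (hX : IsWeaklyStationary P X) (ν : ℝ) :
    (psd P X ν : ℂ) = dtft (autocov P X) ν := by
  rw [psd]
  apply Complex.conj_eq_iff_re.1
  rw [conj_dtft, dtft_neg hX.autocov_neg]

theorem psd_neg (hX : IsWeaklyStationary P X) (ν : ℝ) : psd P X (-ν) = psd P X ν := by
  rw [psd, psd, dtft_neg hX.autocov_neg]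

theorem continuous_psd (hs : Summable fun τ => |autocov P X τ|) : Continuous (psd P X) :=
  Complex.continuous_re.comp (continuous_dtft hs)

theorem IsWeaklyStationary.hasBoundedSpectrum (hX : IsWeaklyStationary P X)
    (hs : Summable fun τ => |autocov P X τ|) (h0 : ∀ ν, 0 ≤ psd P X ν) :
    HasBoundedSpectrum P X (psd P X) where
  memLp := hX.memLp
  mean_zero := hX.mean_zero
  measurable := (continuous_psd hs).measurable
  nonneg := h0
  bounded := ⟨_, fun ν => (Complex.re_le_norm _).trans (norm_dtft_le hs ν)⟩
  cov s t := by
    simp only [ofReal_psd hX]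
    rw [freqCoeff_dtft hs, autocov, ← hX.cov_shift s (t - s), add_sub_cancel]

end Psd

/-! ### Quadratic forms of band integrals -/

section Band

variable {m : ℕ}

/-- The squared modulus of the frequency response of the filter with coefficients `b`. -/
noncomputable def firGain (b : EuclideanSpace ℝ (Fin m)) (ν : ℝ) : ℝ :=
  ‖trigPoly Finset.univ (fun i => b i) (fun i : Fin m => ((i : ℕ) : ℤ)) ν‖ ^ 2

@[fun_prop]
theorem continuous_firGain (b : EuclideanSpace ℝ (Fin m)) : Continuous (firGain b) := by
  unfold firGain; fun_prop

theorem firGain_nonneg (b : EuclideanSpace ℝ (Fin m)) (ν : ℝ) : 0 ≤ firGain b ν := sq_nonneg _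

theorem firGain_le (b : EuclideanSpace ℝ (Fin m)) (ν : ℝ) :
    firGain b ν ≤ (∑ i, |b i|) ^ 2 :=
  pow_le_pow_left₀ (norm_nonneg _) (norm_trigPoly_le _ _ _ _) 2

theorem integral_firGain (b : EuclideanSpace ℝ (Fin m)) :
    ∫ ν, firGain b ν ∂freqMeasure = ‖b‖ ^ 2 := by
  rw [EuclideanSpace.norm_sq_eq]
  simp only [firGain, Real.norm_eq_abs, sq_abs]
  exact integral_normSq_trigPoly _ _ _ fun i j h => by
    simpa [Fin.ext_iff] using h

/-- The matrix of the quadratic form `b ↦ ∫ |ĥ(ν/D)|² g(ν) dν`. -/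
noncomputable def bandMatrix (m D : ℕ) (g : ℝ → ℝ) : Matrix (Fin m) (Fin m) ℝ :=
  fun i j => ∫ ν, (freqChar ((i : ℕ) - (j : ℕ)) (ν / D)).re * g ν ∂freqMeasure

variable {D : ℕ} {g : ℝ → ℝ}

theorem bandMatrix_isHermitian : (bandMatrix m D g).IsHermitian := by
  ext i j
  simp only [bandMatrix, Matrix.conjTranspose_apply, star_trivial]
  congr 1; ext ν
  rw [← Complex.conj_re, conj_freqChar, neg_sub]

theorem bandMatrix_trace : (bandMatrix m D g).trace = m * ∫ ν, g ν ∂freqMeasure := by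
  simp [Matrix.trace, bandMatrix, freqChar_zero]

theorem quadForm_bandMatrix (hg : Integrable g freqMeasure) (b : EuclideanSpace ℝ (Fin m)) :
    quadForm (bandMatrix m D g) b = ∫ ν, firGain b (ν / D) * g ν ∂freqMeasure := by
  have hint : ∀ i j : Fin m, Integrable (fun ν => b i * b j *
      ((freqChar ((i : ℕ) - (j : ℕ)) (ν / D)).re * g ν)) freqMeasure := by
    intro i j
    refine (hg.bdd_mul (c := 1) ?_ (Eventually.of_forall fun ν => ?_)).const_mul _
    · exact (Complex.continuous_re.comp ((continuous_freqChar _).comp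
        (continuous_id.div_const _))).aestronglyMeasurable
    · exact (Complex.abs_re_le_norm _).trans (norm_freqChar _ _).le
  have hgain : ∀ ν, firGain b ν
      = ∑ i : Fin m, ∑ j : Fin m, b i * b j * (freqChar ((i : ℕ) - (j : ℕ)) ν).re := by
    intro ν
    have := congrArg Complex.re (normSq_trigPoly Finset.univ (fun i => b i)
      (fun i : Fin m => ((i : ℕ) : ℤ)) ν)
    rw [Complex.ofReal_re] at this
    rw [firGain, this]
    simp only [Complex.re_sum, ← Complex.ofReal_mul, Complex.re_ofReal_mul]
  simp only [quadForm, bandMatrix, ← integral_const_mul]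
  simp only [hgain, Finset.sum_mul, mul_assoc] at hint ⊢
  rw [integral_finsetSum _ fun i _ => integrable_finsetSum _ fun j _ => hint i j]
  exact Finset.sum_congr rfl fun i _ => (integral_finsetSum _ fun j _ => hint i j).symm

theorem integral_comp_div_freqMeasure (hD : 1 ≤ D) (f : ℝ → ℝ) :
    ∫ ν, f (ν / D) ∂freqMeasure
      = D * ∫ ν in (-(1 / (2 * (D : ℝ))))..(1 / (2 * (D : ℝ))), f ν := by
  have hDne : (D : ℝ) ≠ 0 := by positivity
  rw [freqMeasure, ← intervalIntegral.integral_of_le (by norm_num),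
    intervalIntegral.integral_comp_div f hDne, smul_eq_mul]
  congr 2 <;> field_simp

/-- The left side is `D` times the energy in the band, at most `D` times the full energy `‖b‖²`. -/
theorem integral_firGain_div_le (hD : 1 ≤ D) (b : EuclideanSpace ℝ (Fin m)) :
    ∫ ν, firGain b (ν / D) ∂freqMeasure ≤ D * ‖b‖ ^ 2 := by
  have hD0 : (1 : ℝ) ≤ D := by exact_mod_cast hD
  have hr1 : 1 / (2 * (D : ℝ)) ≤ 1 / 2 := by
    rw [div_le_div_iff₀ (by positivity) (by norm_num)]; linarith
  have hr0 : 0 < 1 / (2 * (D : ℝ)) := by positivity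
  rw [integral_comp_div_freqMeasure hD, ← integral_firGain b]
  refine mul_le_mul_of_nonneg_left ?_ (by positivity)
  rw [freqMeasure, ← intervalIntegral.integral_of_le (by norm_num)]
  exact intervalIntegral.integral_mono_interval (by linarith) (by linarith) hr1
    (Eventually.of_forall fun ν => firGain_nonneg b ν)
    ((continuous_firGain b).intervalIntegrable _ _)

end Band

/-! ### The spectral dependency ratio as a ratio of quadratic forms -/

section Ratio

variable {Ω : Type*} [MeasurableSpace Ω] {P : Measure Ω} {X : ℤ → Ω → ℝ}

theorem freqAvg_eq (f : ℝ → ℝ) : freqAvg f = ∫ ν, f ν ∂freqMeasure :=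
  intervalIntegral.integral_of_le (by norm_num)

theorem freqMeasure_real_univ : freqMeasure.real Set.univ = 1 := by
  rw [freqMeasure, measureReal_restrict_apply_univ, Real.volume_real_Ioc]; norm_num

/-- The spectral dependency ratio of decimated series, as a ratio of band integrals. -/
theorem sdr_downsample_eq [IsProbabilityMeasure P] {S : ℝ → ℝ} (hX : HasBoundedSpectrum P X S)
    (hpos : ∀ ν, 0 < S ν) {D : ℕ} (hD : 1 ≤ D) {a : ℤ → ℝ} (ha : IsIdealAntiAliasing D a) {m : ℕ}
    (k : ℤ) (b : EuclideanSpace ℝ (Fin m)) :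
    sdr P (downsample P a D X) (downsample P a D (filterOutput (firResponse k b) X))
      = (∫ ν, firGain b (ν / D) * S (ν / D) ∂freqMeasure) /
        ((∫ ν, S (ν / D) ∂freqMeasure) * ∫ ν, firGain b (ν / D) ∂freqMeasure) := by
  have hDne : (D : ℝ) ≠ 0 := by positivity
  have h1 := (hX.downsample hD ha).spectralDensity_ae_eq
  have h2 := ((hX.fir k b).downsample hD ha).spectralDensity_ae_eq
  have e1 : freqAvg (spectralDensity P (downsample P a D X))
      = (∫ ν, S (ν / D) ∂freqMeasure) / D := by
    rw [freqAvg_eq, integral_congr_ae h1, integral_div]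
  have e2 : freqAvg (spectralDensity P (downsample P a D (filterOutput (firResponse k b) X)))
      = (∫ ν, firGain b (ν / D) * S (ν / D) ∂freqMeasure) / D := by
    rw [freqAvg_eq, integral_congr_ae h2, integral_div]
    rfl
  have e3 : freqAvg (fun ν =>
      spectralDensity P (downsample P a D (filterOutput (firResponse k b) X)) ν /
        spectralDensity P (downsample P a D X) ν) = ∫ ν, firGain b (ν / D) ∂freqMeasure := by
    rw [freqAvg_eq]
    refine integral_congr_ae ?_
    filter_upwards [h1, h2] with ν h1 h2
    rw [h1, h2, div_div_div_cancel_right₀ hDne, mul_div_cancel_right₀ _ (hpos _).ne']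
    rfl
  rw [sdr, e1, e2, e3, div_mul_eq_mul_div, div_div_div_cancel_right₀ hDne]

/-- Evenness of `S` makes the one-sided integral in `K` half of the band integral, so `K/(2D)` is
the supremum of `S(ν/D)/I` over the open interval. That function has mean one, hence the lower
bound. -/
theorem bandConstant_bounds (hX : IsWeaklyStationary P X)
    (hs : Summable fun τ => |autocov P X τ|) (hpos : ∀ ν, 0 < psd P X ν) {D : ℕ} (hD : 1 ≤ D) :
    0 < ∫ ν, psd P X (ν / D) ∂freqMeasure ∧
    (∀ᵐ ν ∂freqMeasure, psd P X (ν / D) / (∫ ν, psd P X (ν / D) ∂freqMeasure)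
      ≤ bandConstant D (psd P X) / (2 * D)) ∧
    1 ≤ bandConstant D (psd P X) / (2 * D) := by
  set S := psd P X
  have hS : Continuous S := continuous_psd hs
  have hD0 : (0 : ℝ) < D := by exact_mod_cast hD
  set r := 1 / (2 * (D : ℝ)) with hr
  have hr0 : 0 < r := by positivity
  set J := ∫ ν in (0 : ℝ)..r, S ν with hJ
  have hJ0 : 0 < J := intervalIntegral.intervalIntegral_pos_of_pos
    (hS.intervalIntegrable _ _) hpos hr0
  have hneg : ∫ ν in (-r)..0, S ν = J := by
    have := intervalIntegral.integral_comp_neg (a := 0) (b := r) S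
    rw [neg_zero] at this
    rw [← this]
    simp only [S, psd_neg hX, hJ]
  have hI : ∫ ν, S (ν / D) ∂freqMeasure = 2 * D * J := by
    rw [integral_comp_div_freqMeasure hD, ← intervalIntegral.integral_add_adjacent_intervals
      (hS.intervalIntegrable (-r) 0) (hS.intervalIntegrable 0 r), hneg]
    ring
  have hbdd : BddAbove (S '' {ν : ℝ | |ν| < r}) := by
    refine ⟨∑' t, |autocov P X t|, ?_⟩
    rintro _ ⟨ν, _, rfl⟩
    exact (Complex.re_le_norm _).trans (norm_dtft_le hs ν)
  have hae : ∀ᵐ ν ∂freqMeasure, S (ν / D) / (∫ ν, S (ν / D) ∂freqMeasure)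
      ≤ bandConstant D S / (2 * D) := by
    -- The supremum in `K` is over the open band, so the endpoint `1/2` is discarded as a null set.
    rw [freqMeasure, ← restrict_Ioo_eq_restrict_Ioc, ae_restrict_iff' measurableSet_Ioo]
    refine Eventually.of_forall fun ν hν => ?_
    rw [restrict_Ioo_eq_restrict_Ioc, ← freqMeasure, hI, bandConstant, div_div,
      mul_comm (2 * (D : ℝ)) J]
    refine div_le_div_of_nonneg_right (le_csSup hbdd ⟨ν / D, ?_, rfl⟩) (by positivity)
    change |ν / D| < r
    rw [abs_div, abs_of_pos hD0, div_lt_iff₀ hD0, hr]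
    have h2 : |ν| < 1 / 2 := abs_lt.2 ⟨by linarith [hν.1], hν.2⟩
    calc |ν| < 1 / 2 := h2
      _ = 1 / (2 * (D : ℝ)) * D := by field_simp
  have hI0 : 0 < ∫ ν, S (ν / D) ∂freqMeasure := by rw [hI]; positivity
  refine ⟨hI0, hae, ?_⟩
  have hint : Integrable (fun ν => S (ν / D)) freqMeasure := by
    by_contra h
    rw [integral_undef h] at hI0
    exact lt_irrefl _ hI0
  have := integral_mono_ae (hint.div_const _) (integrable_const _) hae
  rw [integral_div, div_self hI0.ne', integral_const, freqMeasure_real_univ, one_smul] at this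
  exact this

/-- The trace free form whose ratio to the band energy of the filter is the deviation of the
spectral dependency ratio from one. -/
theorem sdr_sub_one_estimates [IsProbabilityMeasure P] (hX : IsWeaklyStationary P X)
    (hs : Summable fun τ => |autocov P X τ|) (hpos : ∀ ν, 0 < psd P X ν) {D : ℕ} (hD : 1 ≤ D)
    {a : ℤ → ℝ} (ha : IsIdealAntiAliasing D a) (m : ℕ) :
    ∃ M T : Matrix (Fin m) (Fin m) ℝ, M.IsHermitian ∧ T.IsHermitian ∧ M.trace = 0 ∧ T.trace = m ∧
      (∀ b, 0 ≤ quadForm T b) ∧ (∀ b, quadForm T b ≤ D * ‖b‖ ^ 2) ∧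
      (∀ b, |quadForm M b| ≤ quadForm T b / (2 * D)) ∧
      ∀ k b, sdr P (downsample P a D X) (downsample P a D (filterOutput (firResponse k b) X))
        = (quadForm T b + bandConstant D (psd P X) * quadForm M b) / quadForm T b := by
  obtain ⟨hI0, hae, hK⟩ := bandConstant_bounds hX hs hpos hD
  have hB := hX.hasBoundedSpectrum hs fun ν => (hpos ν).le
  have hD0 : (0 : ℝ) < D := by exact_mod_cast hD
  set S := psd P X
  have hS : Continuous S := continuous_psd hs
  set I := ∫ ν, S (ν / D) ∂freqMeasure with hI
  set K := bandConstant D S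
  have hK0 : 0 < K := by
    rw [le_div_iff₀ (by positivity)] at hK; linarith
  have hint : Integrable (fun ν => S (ν / D)) freqMeasure := by
    by_contra h
    rw [hI, integral_undef h] at hI0
    exact lt_irrefl _ hI0
  have hgi : Integrable (fun ν => S (ν / D) / I - 1) freqMeasure :=
    (hint.div_const _).sub (integrable_const _)
  have hT : ∀ b, quadForm (bandMatrix m D fun _ => 1) b
      = ∫ ν, firGain b (ν / D) ∂freqMeasure := by
    intro b
    rw [quadForm_bandMatrix (integrable_const _)]
    simp
  have hgain : ∀ (b : EuclideanSpace ℝ (Fin m)) {f : ℝ → ℝ}, Integrable f freqMeasure →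
      Integrable (fun ν => firGain b (ν / D) * f ν) freqMeasure := by
    intro b f hf
    refine hf.bdd_mul (c := (∑ i, |b i|) ^ 2) ?_ (Eventually.of_forall fun ν => ?_)
    · exact ((continuous_firGain b).comp (continuous_id.div_const _)).aestronglyMeasurable
    · rw [Real.norm_eq_abs, abs_of_nonneg (firGain_nonneg _ _)]
      exact firGain_le _ _
  have hgain1 : ∀ b : EuclideanSpace ℝ (Fin m),
      Integrable (fun ν => firGain b (ν / D)) freqMeasure := fun b => by
    simpa using hgain b (integrable_const (1 : ℝ))
  have hN : ∀ b : EuclideanSpace ℝ (Fin m),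
      quadForm (bandMatrix m D fun ν => S (ν / D) / I - 1) b
      = (∫ ν, firGain b (ν / D) * S (ν / D) ∂freqMeasure) / I
        - ∫ ν, firGain b (ν / D) ∂freqMeasure := by
    intro b
    rw [quadForm_bandMatrix hgi, ← integral_div, ← integral_sub ((hgain b hint).div_const _)
      (hgain1 b)]
    congr 1; ext ν; ring
  -- The weight `S(ν/D)/I - 1` has mean zero, so the trace vanishes. It lies between `-1` and
  -- `K/(2D)`, and `1 ≤ K/(2D)`; the factor `K⁻¹` reduces its modulus to at most `1/(2D)`.
  refine ⟨K⁻¹ • bandMatrix m D (fun ν => S (ν / D) / I - 1), bandMatrix m D fun _ => 1,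
    ?_, bandMatrix_isHermitian, ?_, ?_, ?_, ?_, ?_, ?_⟩
  · rw [Matrix.IsHermitian, Matrix.conjTranspose_smul, bandMatrix_isHermitian.eq, star_trivial]
  · rw [Matrix.trace_smul, bandMatrix_trace, integral_sub (hint.div_const _) (integrable_const _),
      integral_div, ← hI, div_self hI0.ne', integral_const, freqMeasure_real_univ]
    simp
  · rw [bandMatrix_trace, integral_const, freqMeasure_real_univ]; simp
  · intro b
    rw [hT]; exact integral_nonneg fun ν => firGain_nonneg _ _
  · intro b
    rw [hT]; exact integral_firGain_div_le hD b
  · intro b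
    rw [quadForm_smul_matrix, hT, quadForm_bandMatrix hgi, abs_mul, abs_of_pos (inv_pos.2 hK0)]
    have h1 : |∫ ν, firGain b (ν / D) * (S (ν / D) / I - 1) ∂freqMeasure|
        ≤ K / (2 * D) * ∫ ν, firGain b (ν / D) ∂freqMeasure := by
      rw [← integral_const_mul, ← Real.norm_eq_abs]
      refine norm_integral_le_of_norm_le ((hgain1 b).const_mul _) ?_
      filter_upwards [hae] with ν hν
      rw [Real.norm_eq_abs, abs_mul, abs_of_nonneg (firGain_nonneg _ _), mul_comm]
      refine mul_le_mul_of_nonneg_right ?_ (firGain_nonneg _ _)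
      have : 0 ≤ S (ν / D) / I := div_nonneg (hpos _).le hI0.le
      rw [abs_le]; constructor <;> linarith
    calc K⁻¹ * |∫ ν, firGain b (ν / D) * (S (ν / D) / I - 1) ∂freqMeasure|
        ≤ K⁻¹ * (K / (2 * D) * ∫ ν, firGain b (ν / D) ∂freqMeasure) := by gcongr
      _ = (∫ ν, firGain b (ν / D) ∂freqMeasure) / (2 * D) := by field_simp
  · intro k b
    rw [sdr_downsample_eq hB hpos hD ha, quadForm_smul_matrix, mul_inv_cancel_left₀ hK0.ne', hN, hT,
      add_sub_cancel, div_div]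

end Ratio

/-! ### The main theorem -/

theorem mainTheorem6 :
    ∃ κ : ℝ, 0 < κ ∧
      ∀ (Ω : Type*) [MeasurableSpace Ω] (P : Measure Ω) [IsProbabilityMeasure P]
        (X : ℤ → Ω → ℝ), IsWeaklyStationary P X →
        Summable (fun τ => |autocov P X τ|) → (∀ ν : ℝ, 0 < psd P X ν) →
      ∀ D : ℕ, 1 ≤ D → ∀ a : ℤ → ℝ, IsIdealAntiAliasing D a →
      ∀ m : ℕ, 1 ≤ m → ∀ k : ℤ,
        DownsampleWellDefined P a D X ∧
        (∀ b : EuclideanSpace ℝ (Fin m),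
          DownsampleWellDefined P a D (filterOutput (firResponse k b) X)) ∧
        ∀ (μ : Measure (EuclideanSpace ℝ (Fin m))) [IsProbabilityMeasure μ],
          IsSphericallySymmetric μ → μ {0} = 0 →
        ∀ ε : ℝ, 0 < ε → ε < 1 / 2 →
          ENNReal.ofReal ((1 - Real.exp (-(κ * ((m : ℝ) - 1) * ε ^ 2))) ^ 2) ≤
            μ {b | |sdr P (downsample P a D X)
                      (downsample P a D (filterOutput (firResponse k b) X)) - 1| ≤
                ε * (bandConstant D (psd P X) +
                  (1 + ε * bandConstant D (psd P X)) * (2 / (1 - 2 * ε)))} := by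
  obtain ⟨κ, hκ, hcone⟩ := exists_stdGaussian_ratioCone
  refine ⟨κ, hκ, ?_⟩
  intro Ω _ P _ X hX hs hpos D hD a ha m hm k
  have hB := hX.hasBoundedSpectrum hs fun ν => (hpos ν).le
  refine ⟨hB.downsampleWellDefined hD ha, fun b => (hB.fir k b).downsampleWellDefined hD ha, ?_⟩
  intro μ _ hμ hμ0 ε hε0 hε
  have : NeZero m := ⟨by omega⟩
  obtain ⟨-, -, hK⟩ := bandConstant_bounds hX hs hpos hD
  obtain ⟨M, T, hM, hT, hMtr, hTtr, hT0, hTD, hMT, hsdr⟩ :=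
    sdr_sub_one_estimates hX hs hpos hD ha m
  set K := bandConstant D (psd P X)
  have hD0 : (1 : ℝ) ≤ D := by exact_mod_cast hD
  have hm1 : (1 : ℝ) ≤ m := by exact_mod_cast hm
  have hKD : 2 * (D : ℝ) ≤ K := by rwa [le_div_iff₀ (by positivity), one_mul] at hK
  have hK0 : 0 < K := by linarith
  have hrhs : ε * K ≤ ε * (K + (1 + ε * K) * (2 / (1 - 2 * ε))) := by
    refine mul_le_mul_of_nonneg_left (le_add_of_nonneg_right ?_) hε0.le
    exact mul_nonneg (by positivity) (div_nonneg (by norm_num) (by linarith))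
  have hdev : ∀ b, 0 < quadForm T b →
      |sdr P (downsample P a D X) (downsample P a D (filterOutput (firResponse k b) X)) - 1|
        = K * |quadForm M b| / quadForm T b := by
    intro b hb
    rw [hsdr, add_div, div_self hb.ne', add_sub_cancel_left, abs_div, abs_mul, abs_of_pos hK0,
      abs_of_pos hb]
  have hcone_sub : ∀ b ∈ ratioCone M T ε,
      |sdr P (downsample P a D X) (downsample P a D (filterOutput (firResponse k b) X)) - 1|
        ≤ ε * K := by
    rintro b ⟨hb, hbM⟩
    rw [hdev b hb, div_le_iff₀ hb]
    nlinarith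
  -- Below this threshold `εT ≤ εD‖b‖² ≤ ‖b‖²/2`, as the cone estimate requires; above it `|M| ≤
  -- T/(2D)` makes the bound hold for every `b`.
  rcases lt_or_ge ε (1 / (2 * D)) with hεD | hεD
  · have hεD' : ε * D ≤ 1 / 2 := by
      rw [lt_div_iff₀ (by positivity)] at hεD; linarith
    have hMb : ∀ b, |quadForm M b| ≤ 1 / 2 * ‖b‖ ^ 2 := fun b => by
      refine (hMT b).trans ?_
      rw [div_le_iff₀ (by positivity)]; linarith [hTD b]
    have hTb : ∀ b, ε * quadForm T b ≤ 1 / 2 * ‖b‖ ^ 2 := fun b => by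
      nlinarith [mul_le_mul_of_nonneg_left (hTD b) hε0.le,
        mul_le_mul_of_nonneg_right hεD' (sq_nonneg ‖b‖)]
    have hprob := hcone (Fin m) M T hM hT hMtr (by simpa using hTtr) hMb hT0 ε hε0.le hε.le hTb
    have hμS := measure_cone_eq_stdGaussian hμ hμ0 (measurableSet_ratioCone M T ε) fun x hx c hc => by
      have hc2 : 0 < c ^ 2 := by positivity
      refine ⟨?_, ?_⟩
      · rw [quadForm_smul]; exact mul_pos hc2 hx.1
      · rw [quadForm_smul, quadForm_smul, abs_mul, abs_of_pos hc2]
        nlinarith [mul_le_mul_of_nonneg_left hx.2 hc2.le]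
    have hexp : (1 - Real.exp (-(κ * ((m : ℝ) - 1) * ε ^ 2))) ^ 2
        ≤ (1 - Real.exp (-(κ * (Fintype.card (Fin m) : ℝ) * ε ^ 2))) ^ 2 := by
      rw [Fintype.card_fin]
      refine pow_le_pow_left₀ ?_ ?_ 2
      · have : 0 ≤ κ * ((m : ℝ) - 1) * ε ^ 2 :=
          mul_nonneg (mul_nonneg hκ.le (by linarith)) (sq_nonneg _)
        linarith [Real.exp_le_one_iff.2 (neg_nonpos.2 this)]
      · gcongr; linarith
    calc ENNReal.ofReal ((1 - Real.exp (-(κ * ((m : ℝ) - 1) * ε ^ 2))) ^ 2)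
        ≤ ENNReal.ofReal ((ProbabilityTheory.stdGaussian (EuclideanSpace ℝ (Fin m))).real
            (ratioCone M T ε)) := ENNReal.ofReal_le_ofReal (hexp.trans hprob)
      _ = μ (ratioCone M T ε) := by rw [hμS, ofReal_measureReal]
      _ ≤ _ := measure_mono fun b hb => (hcone_sub b hb).trans hrhs
  · have hall : ∀ b : EuclideanSpace ℝ (Fin m), |sdr P (downsample P a D X)
        (downsample P a D (filterOutput (firResponse k b) X)) - 1| ≤ ε * K := by
      intro b
      have hεD1 : 1 ≤ ε * (2 * D) := by rwa [div_le_iff₀ (by positivity)] at hεD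
      rcases (hT0 b).eq_or_lt with h0 | hb
      -- When `T(b) = 0` the ratio is zero by convention; the deviation 1 is covered since `1 ≤ ε·2D
      -- ≤ εK`.
      · rw [hsdr, ← h0, div_zero, zero_sub, abs_neg, abs_one]
        nlinarith
      · refine hcone_sub b ⟨hb, (hMT b).trans ?_⟩
        rw [div_eq_mul_one_div, mul_comm]
        gcongr
    rw [show {b : EuclideanSpace ℝ (Fin m) | |sdr P (downsample P a D X)
        (downsample P a D (filterOutput (firResponse k b) X)) - 1|
          ≤ ε * (K + (1 + ε * K) * (2 / (1 - 2 * ε)))} = Set.univ from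
      Set.eq_univ_of_forall fun b => (hall b).trans hrhs, measure_univ, ENNReal.ofReal_le_one]
    have h1 := Real.exp_pos (-(κ * ((m : ℝ) - 1) * ε ^ 2))
    have : 0 ≤ κ * ((m : ℝ) - 1) * ε ^ 2 :=
      mul_nonneg (mul_nonneg hκ.le (by linarith)) (sq_nonneg _)
    have h2 := Real.exp_le_one_iff.2 (neg_nonpos.2 this)
    nlinarith
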